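/- Let $\|\cdot\|$ be the $\ell_1$, $\ell_2$ or $\ell_\infty$ norm on $\mathbb{R}^d$. In the problem MeanEstimation, each of $n\ge 1$ machines $v$ receives a vector $x_v\in\mathbb{R}^d$, and all machines receive a common real number $y$ with the guarantee that $\|x_u-x_v\|\le y$ for all machines $u,v$. The machines exchange messages, and all of them have to output the same vector $\mathrm{EST}\in\mathbb{R}^d$, which has to be an unbiased estimator of the mean: $\mathbb{E}[\mathrm{EST}]=\mu:=\frac1n\sum_v x_v$. The inputs are deterministic; all randomness is that of the protocol, which consists of the machines' private randomness and of a uniformly random assignment of the machines to the roles of a fixed communication structure (setting up this structure is not charged). For every constant $q_0>1$ there is a constant $C>0$, depending on $q_0$ only, such that for each of the three norms, all $n\ge 1$, all $d$ and all real $q\ge q_0$, there is a protocol in which every machine with certainty sends and receives at most $C\,d\log_2 q$ bits in total, and which solves MeanEstimation for all $y$ and all inputs with pairwise distances at most $y$, with output variance $$\mathbb{E}\,\|\mathrm{EST}-\mathbb{E}[\mathrm{EST}]\|^2\le C\,\frac{y^2}{q}.$$ In particular the bound does not depend on the norms of the inputs. -/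

import Mathlib

open scoped ENNReal

noncomputable section

namespace MeanEst

/-- The `ℓ_p` norm of a vector of `ℝ^d`; it is used for `p = 1`, `p = 2` and `p = ∞` only. -/
def vecNorm (p : ℝ≥0∞) {d : ℕ} (x : Fin d → ℝ) : ℝ := ‖WithLp.toLp p x‖

/-- The mean `(1/n) ∑ v, x v` of the inputs. -/
def mean {n d : ℕ} (x : Fin n → Fin d → ℝ) : Fin d → ℝ := (n : ℝ)⁻¹ • ∑ v, x v

/-- A message-passing protocol for `n` roles, each of which is played by one machine that holds
the common real `y` and a vector of `ℝ^d`.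

The protocol is a finite sequence of point-to-point transmissions. Sender, receiver and number of
bits of each transmission are fixed in advance, so that no information can be hidden in the timing,
in the addressee or in the length of a message: all information travels in the counted bits.

The content of a transmission is sampled, with fresh private randomness of the sender, from a
distribution that depends on the local knowledge of the sender only: the common value `y`, its own
vector, and the transmissions that it has sent or received so far. A family of type
`(i : Fin steps) → Option (Fin (len i) → Bool)` records which transmissions a machine has seen,
with their contents (`none`: not seen). -/
structure Protocol (n d : ℕ) where
  /-- number of transmissions -/
  steps : ℕ
  /-- the role that sends the `i`-th transmission -/
  sender : Fin steps → Fin n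
  /-- the role that receives the `i`-th transmission -/
  receiver : Fin steps → Fin n
  /-- number of bits of the `i`-th transmission -/
  len : Fin steps → ℕ
  /-- distribution of the `i`-th transmission, from the common value, the vector of its sender and
  what the sender has seen -/
  send : (i : Fin steps) → ℝ → (Fin d → ℝ) → ((j : Fin steps) → Option (Fin (len j) → Bool)) →
    PMF (Fin (len i) → Bool)
  /-- the output in each role, from the common value, the own vector and what was seen -/
  output : Fin n → ℝ → (Fin d → ℝ) → ((j : Fin steps) → Option (Fin (len j) → Bool)) →
    (Fin d → ℝ)

namespace Protocol

variable {n d : ℕ} (P : Protocol n d)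

/-- The contents of all transmissions. -/
abbrev Transcript : Type := (i : Fin P.steps) → Fin (P.len i) → Bool

/-- The number of bits that the machine in role `r` sends and receives altogether. -/
def bits (r : Fin n) : ℕ :=
  (∑ i, if P.sender i = r then P.len i else 0) + ∑ i, if P.receiver i = r then P.len i else 0

/-- What the machine in role `r` has seen of the transcript `τ` before transmission number `k`:
the earlier transmissions that it sent or received. -/
def view (r : Fin n) (k : ℕ) (τ : P.Transcript) :
    (i : Fin P.steps) → Option (Fin (P.len i) → Bool) :=
  fun i => if (i : ℕ) < k ∧ (P.sender i = r ∨ P.receiver i = r) then some (τ i) else none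

/-- The law of the transcript after the first `k` transmissions (entries not yet written are
all-false), where `z r` is the vector held in role `r`. -/
def transcriptLaw (y : ℝ) (z : Fin n → Fin d → ℝ) : ℕ → PMF P.Transcript
  | 0 => PMF.pure fun _ _ => false
  | k + 1 => (transcriptLaw y z k).bind fun τ =>
      if h : k < P.steps then
        (P.send ⟨k, h⟩ y (z (P.sender ⟨k, h⟩)) (P.view (P.sender ⟨k, h⟩) k τ)).map
          fun m => Function.update τ ⟨k, h⟩ m
      else PMF.pure τ

/-- An outcome of an execution: the assignment of the machines to the roles (machine `v` plays role
`ω.1 v`), and the transcript. -/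
abbrev Outcome : Type := Equiv.Perm (Fin n) × P.Transcript

/-- The law of an execution in which machine `v` holds `x v`: the machines are assigned to the
roles by a uniformly random bijection (this is the sampling of machines and their arrangement into
a communication structure), and then the transmissions take place. -/
def law (y : ℝ) (x : Fin n → Fin d → ℝ) : PMF P.Outcome :=
  (PMF.uniformOfFintype (Equiv.Perm (Fin n))).bind fun σ =>
    (P.transcriptLaw y (fun r => x (σ.symm r)) P.steps).map fun τ => (σ, τ)

/-- The output of machine `v` in the outcome `ω`. -/
def machineOutput (y : ℝ) (x : Fin n → Fin d → ℝ) (v : Fin n) (ω : P.Outcome) : Fin d → ℝ :=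
  P.output (ω.1 v) y (x v) (P.view (ω.1 v) P.steps ω.2)

/-- The number of bits that machine `v` sends and receives in the outcome `ω`. -/
def machineBits (v : Fin n) (ω : P.Outcome) : ℕ := P.bits (ω.1 v)

/-- The expectation of a vector that depends on the outcome. -/
def expVec (y : ℝ) (x : Fin n → Fin d → ℝ) (X : P.Outcome → Fin d → ℝ) : Fin d → ℝ :=
  ∑ ω, (P.law y x ω).toReal • X ω

/-- The variance `E ‖X - E X‖²` under the `ℓ_p` norm. -/
def variance (p : ℝ≥0∞) (y : ℝ) (x : Fin n → Fin d → ℝ) (X : P.Outcome → Fin d → ℝ) : ℝ :=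
  ∑ ω, (P.law y x ω).toReal * vecNorm p (X ω - P.expVec y x X) ^ 2

/-- On the inputs `x` and the common value `y`, with certainty all machines output the same value
`EST`, whose expectation is the mean of the inputs and whose variance is at most `s`. -/
def EstimatesMean (p : ℝ≥0∞) (y : ℝ) (x : Fin n → Fin d → ℝ) (s : ℝ) : Prop :=
  ∃ EST : P.Outcome → Fin d → ℝ,
    (∀ ω ∈ (P.law y x).support, ∀ v, P.machineOutput y x v ω = EST ω) ∧
    P.expVec y x EST = mean x ∧
    P.variance p y x EST ≤ s

end Protocol

end MeanEst

end

/-!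
# Mean estimation with `O(d log q)` bits per machine and variance `O(y² / q)`

Let `Q = ⌈q⌉`. Only the machines in the roles below `m = min n (d Q)` contribute to the estimate.
The error of this sampling without replacement has variance at most `y² / Q` in each of the three
norms, since their squares are comparable with the sum of squares up to a total factor of `d`
(`expect_sampling_error_le`). It remains to estimate the mean of the sample, without bias and with
variance `O(y² / Q)`, and the errors add up (`Protocol.estimatesMean_of_sampleMean`).

For the `ℓ_1` and `ℓ_2` norms, only the following is used: the `ℓ_1` distances of the inputs are at
most `Y`, where `Y = y` and `Y = √d y` respectively, and it suffices to have expected squared error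
`O(Y² / (d Q))` in the Euclidean norm. One message is passed around the ring of all roles. It
contains a common reference vector, a rounding of one of the inputs, which can be sent with `O(d)`
bits because all machines know it up to an `ℓ_1` error of `2 Y`: a proper colouring of the lattice
is used, in which points that could be confused have different colours (`exists_colouring`). The
difference of an input and the reference is `2 Y` times the expectation of a random vector that is
zero or a signed unit vector. Each of the `m` machines draws about `d Q / m` independent samples of
this random vector and adds them to the message. The sum is an integer vector of `ℓ_1` norm at most
`2 d Q`, and there are only `O(Q)ᵈ` of these (`card_intBall_le`), so that it can be sent exactly
with `O(d log Q)` bits. It is made from at least `d Q` independent samples, which gives the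
variance (`ringProtocol_correct`).

For the `ℓ_∞` norm, independent errors in the `d` coordinates would cost a factor `log d`, so that
the rounding errors must be bounded with certainty. Each coordinate is treated separately, modulo
`O(Q²)` on a grid of width `y / Q`: as the values of all machines are close to each other, residues
are enough. The machines are divided into at most `Q` groups of about `B = min n d` machines. The
members of a group send each coordinate to one of them, the collector; the collectors of the
different groups add up the averages of their groups in a chain. As there are at most `Q` groups,
the sum has `O(log Q)` bits, and each rounding contributes at most one grid width to the average
(`scatterProtocol_correct`). The `d` coordinates have different collectors, so that each machine
handles `O(d)` messages (`scatterProtocol_bits_le`).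

The analysis of both protocols rests on two properties of the law of the transcript: every message
is a possible reaction to what its sender has seen (`Protocol.mem_support_send`), and the messages
may be averaged over one at a time (`Protocol.expect_transcriptLaw_tower`).
-/

noncomputable section

namespace MeanEst

/-! ### Expectations over finite types -/

section Expectation

variable {α β : Type*} [Fintype α] [Fintype β]

/-- The expectation of a real function under a probability mass function on a finite type. -/
def expect (μ : PMF α) (f : α → ℝ) : ℝ := ∑ a, (μ a).toReal * f a

lemma sum_toReal_eq_one (μ : PMF α) : ∑ a, (μ a).toReal = 1 := by
  rw [← ENNReal.toReal_sum fun a _ => μ.apply_ne_top a, ← tsum_fintype (L := .unconditional _),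
    μ.tsum_coe, ENNReal.toReal_one]

lemma expect_const (μ : PMF α) (c : ℝ) : expect μ (fun _ => c) = c := by
  rw [expect, ← Finset.sum_mul, sum_toReal_eq_one, one_mul]

lemma expect_congr {μ : PMF α} {f g : α → ℝ} (h : ∀ a ∈ μ.support, f a = g a) :
    expect μ f = expect μ g := by
  refine Finset.sum_congr rfl fun a _ => ?_
  by_cases ha : a ∈ μ.support
  · rw [h a ha]
  · rw [(μ.apply_eq_zero_iff a).2 ha]; simp

lemma expect_mono {μ : PMF α} {f g : α → ℝ} (h : ∀ a ∈ μ.support, f a ≤ g a) :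
    expect μ f ≤ expect μ g := by
  refine Finset.sum_le_sum fun a _ => ?_
  by_cases ha : a ∈ μ.support
  · exact mul_le_mul_of_nonneg_left (h a ha) ENNReal.toReal_nonneg
  · rw [(μ.apply_eq_zero_iff a).2 ha]; simp

lemma expect_add (μ : PMF α) (f g : α → ℝ) :
    expect μ (fun a => f a + g a) = expect μ f + expect μ g := by
  simp only [expect, mul_add, Finset.sum_add_distrib]

lemma expect_sub (μ : PMF α) (f g : α → ℝ) :
    expect μ (fun a => f a - g a) = expect μ f - expect μ g := by
  simp only [expect, mul_sub, Finset.sum_sub_distrib]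

lemma expect_const_mul (μ : PMF α) (c : ℝ) (f : α → ℝ) :
    expect μ (fun a => c * f a) = c * expect μ f := by
  simp only [expect, Finset.mul_sum]
  exact Finset.sum_congr rfl fun a _ => by ring

lemma expect_sum {ι : Type*} (s : Finset ι) (μ : PMF α) (f : ι → α → ℝ) :
    expect μ (fun a => ∑ i ∈ s, f i a) = ∑ i ∈ s, expect μ (f i) := by
  simp only [expect, Finset.mul_sum]
  exact Finset.sum_comm

lemma expect_pure (a : α) (f : α → ℝ) : expect (PMF.pure a) f = f a := by
  rw [expect_congr (g := fun _ => f a), expect_const]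
  intro b hb
  rw [PMF.mem_support_pure_iff] at hb
  rw [hb]

lemma expect_bind (μ : PMF α) (κ : α → PMF β) (f : β → ℝ) :
    expect (μ.bind κ) f = expect μ fun a => expect (κ a) f := by
  simp only [expect, PMF.bind_apply, tsum_fintype, Finset.mul_sum]
  rw [Finset.sum_comm]
  refine Finset.sum_congr rfl fun b _ => ?_
  rw [ENNReal.toReal_sum fun a _ =>
    ENNReal.mul_ne_top (μ.apply_ne_top a) ((κ a).apply_ne_top b), Finset.sum_mul]
  refine Finset.sum_congr rfl fun a _ => ?_
  rw [ENNReal.toReal_mul, mul_assoc]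

lemma expect_map (μ : PMF α) (g : α → β) (f : β → ℝ) :
    expect (μ.map g) f = expect μ fun a => f (g a) := by
  rw [← PMF.bind_pure_comp, expect_bind]
  simp only [Function.comp, expect_pure]

end Expectation

/-! ### Executions of a protocol -/

namespace Protocol

variable {n d : ℕ} (P : Protocol n d)

lemma view_update (r : Fin n) {j : ℕ} {k : Fin P.steps} (hjk : j ≤ k) (τ : P.Transcript)
    (m : Fin (P.len k) → Bool) : P.view r j (Function.update τ k m) = P.view r j τ := by
  funext i
  unfold view
  by_cases hi : (i : ℕ) < j
  · have : i ≠ k := by rintro rfl; omega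
    rw [Function.update_of_ne this]
  · simp [hi]

/-- Each message of a possible transcript is a possible reaction of its sender to what the sender
has seen before. -/
lemma mem_support_send {y : ℝ} {z : Fin n → Fin d → ℝ} {k : ℕ} {τ : P.Transcript}
    (hτ : τ ∈ (P.transcriptLaw y z k).support) (j : Fin P.steps) (hj : (j : ℕ) < k) :
    τ j ∈ (P.send j y (z (P.sender j)) (P.view (P.sender j) j τ)).support := by
  induction k generalizing τ with
  | zero => omega
  | succ k ih =>
    rw [transcriptLaw, PMF.mem_support_bind_iff] at hτ
    obtain ⟨τ', hτ', h⟩ := hτ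
    split_ifs at h with hk
    · rw [PMF.mem_support_map_iff] at h
      obtain ⟨m, hm, rfl⟩ := h
      rw [P.view_update _ (k := ⟨k, hk⟩) (by simp only; omega)]
      by_cases hjk : j = ⟨k, hk⟩
      · subst hjk
        rw [Function.update_self]
        exact hm
      · rw [Function.update_of_ne hjk]
        have : (j : ℕ) ≠ k := fun h => hjk (Fin.ext h)
        exact ih hτ' (by omega)
    · rw [PMF.mem_support_pure_iff] at h
      subst h
      exact ih hτ' (by have := j.2; omega)

lemma expect_transcriptLaw_succ (y : ℝ) (z : Fin n → Fin d → ℝ) (j : Fin P.steps)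
    (h : P.Transcript → ℝ) :
    expect (P.transcriptLaw y z (j + 1)) h = expect (P.transcriptLaw y z j) fun τ =>
      expect (P.send j y (z (P.sender j)) (P.view (P.sender j) j τ)) fun m =>
        h (Function.update τ j m) := by
  rw [transcriptLaw, expect_bind]
  congr 1
  funext τ
  rw [dif_pos j.2, expect_map]

/-- The law of the first messages is not changed by the later ones. -/
lemma expect_transcriptLaw_of_le (y : ℝ) (z : Fin n → Fin d → ℝ) (h : P.Transcript → ℝ)
    {j k : ℕ} (hjk : j ≤ k)
    (hh : ∀ τ τ' : P.Transcript, (∀ i : Fin P.steps, (i : ℕ) < j → τ i = τ' i) → h τ = h τ') :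
    expect (P.transcriptLaw y z k) h = expect (P.transcriptLaw y z j) h := by
  induction k, hjk using Nat.le_induction with
  | base => rfl
  | succ k hk ih =>
    rw [← ih]
    by_cases hks : k < P.steps
    · rw [P.expect_transcriptLaw_succ y z ⟨k, hks⟩]
      congr 1
      funext τ
      rw [← expect_const (P.send ⟨k, hks⟩ y _ (P.view _ k τ)) (h τ)]
      congr 1
      funext m
      refine hh _ _ fun i hi => Function.update_of_ne ?_ _ _
      rintro rfl
      simp only at hi
      omega
    · rw [transcriptLaw, expect_bind]
      congr 1
      funext τ
      rw [dif_neg hks, expect_pure]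

/-- The tower property: a quantity that is determined by the messages up to number `j` may be
averaged over message `j` first, given the earlier messages. -/
lemma expect_transcriptLaw_tower (y : ℝ) (z : Fin n → Fin d → ℝ) (j : Fin P.steps)
    (h : P.Transcript → ℝ)
    (hh : ∀ τ τ' : P.Transcript, (∀ i : Fin P.steps, i ≤ j → τ i = τ' i) → h τ = h τ') :
    expect (P.transcriptLaw y z P.steps) h = expect (P.transcriptLaw y z P.steps) fun τ =>
      expect (P.send j y (z (P.sender j)) (P.view (P.sender j) j τ)) fun m =>
        h (Function.update τ j m) := by
  have hj : (j : ℕ) + 1 ≤ P.steps := j.2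
  rw [P.expect_transcriptLaw_of_le y z h hj fun τ τ' hi => hh τ τ' fun i hij =>
      hi i (by have : (i : ℕ) ≤ j := hij; omega),
    P.expect_transcriptLaw_of_le y z _ j.2.le, P.expect_transcriptLaw_succ]
  intro τ τ' hi
  have hv : P.view (P.sender j) j τ = P.view (P.sender j) j τ' := by
    funext i
    unfold view
    by_cases hij : (i : ℕ) < j
    · rw [hi i hij]
    · simp [hij]
  rw [hv]
  congr 1
  funext m
  refine hh _ _ fun i hij => ?_
  by_cases hij' : i = j
  · subst hij'; simp
  · rw [Function.update_of_ne hij', Function.update_of_ne hij']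
    refine hi i ?_
    have : (i : ℕ) ≠ j := fun h => hij' (Fin.ext h)
    have : (i : ℕ) ≤ j := hij
    omega

end Protocol

/-! ### The three norms -/

section Norms

variable {p : ℝ≥0∞} {d : ℕ}

lemma vecNorm_nonneg (hp : p = 1 ∨ p = 2 ∨ p = ∞) (x : Fin d → ℝ) : 0 ≤ vecNorm p x := by
  rcases hp with rfl | rfl | rfl <;> exact norm_nonneg _

lemma vecNorm_add_le (hp : p = 1 ∨ p = 2 ∨ p = ∞) (x y : Fin d → ℝ) :
    vecNorm p (x + y) ≤ vecNorm p x + vecNorm p y := by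
  rcases hp with rfl | rfl | rfl <;> exact norm_add_le (WithLp.toLp _ x) (WithLp.toLp _ y)

lemma vecNorm_smul (hp : p = 1 ∨ p = 2 ∨ p = ∞) (c : ℝ) (x : Fin d → ℝ) :
    vecNorm p (c • x) = |c| * vecNorm p x := by
  rcases hp with rfl | rfl | rfl <;> exact norm_smul c (WithLp.toLp _ x)

lemma vecNorm_zero (hp : p = 1 ∨ p = 2 ∨ p = ∞) : vecNorm p (0 : Fin d → ℝ) = 0 := by
  simpa using vecNorm_smul hp 0 (0 : Fin d → ℝ)

lemma vecNorm_sum_le (hp : p = 1 ∨ p = 2 ∨ p = ∞) {ι : Type*} (s : Finset ι)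
    (f : ι → Fin d → ℝ) : vecNorm p (∑ j ∈ s, f j) ≤ ∑ j ∈ s, vecNorm p (f j) := by
  classical
  induction s using Finset.induction_on with
  | empty => simp [vecNorm_zero hp]
  | insert a s ha ih =>
    rw [Finset.sum_insert ha, Finset.sum_insert ha]
    exact (vecNorm_add_le hp _ _).trans (by gcongr)

lemma vecNorm_one (x : Fin d → ℝ) : vecNorm 1 x = ∑ i, |x i| := by
  simp [vecNorm, PiLp.norm_eq_of_L1]

lemma vecNorm_two_sq (x : Fin d → ℝ) : vecNorm 2 x ^ 2 = ∑ i, x i ^ 2 := by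
  simp [vecNorm, PiLp.norm_eq_of_L2, Real.sq_sqrt (Finset.sum_nonneg fun i _ => sq_nonneg (x i))]

lemma abs_le_vecNorm_top (x : Fin d → ℝ) (i : Fin d) : |x i| ≤ vecNorm ∞ x := by
  rw [vecNorm, PiLp.norm_toLp]
  exact norm_le_pi_norm x i

lemma vecNorm_top_le {x : Fin d → ℝ} {b : ℝ} (hb : 0 ≤ b) (h : ∀ i, |x i| ≤ b) :
    vecNorm ∞ x ≤ b := by
  rw [vecNorm, PiLp.norm_toLp]
  exact (pi_norm_le_iff_of_nonneg hb).2 h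

/-- Comparison of the square of the norm with the sum of squares, up to a factor that depends on
the norm; going to the sum of squares and back costs a factor `d`. -/
lemma exists_vecNorm_sq_comparison (hp : p = 1 ∨ p = 2 ∨ p = ∞) (hd : 0 < d) :
    ∃ κ : ℝ, 0 ≤ κ ∧ (∀ x : Fin d → ℝ, vecNorm p x ^ 2 ≤ κ * ∑ i, x i ^ 2) ∧
      ∀ x : Fin d → ℝ, κ * ∑ i, x i ^ 2 ≤ d * vecNorm p x ^ 2 := by
  have hd' : (1 : ℝ) ≤ d := by exact_mod_cast hd
  rcases hp with rfl | rfl | rfl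
  · refine ⟨d, by positivity, fun x => ?_, fun x => ?_⟩
    · rw [vecNorm_one]
      simpa using sq_sum_le_card_mul_sum_sq (s := Finset.univ) (f := fun i => |x i|)
    · rw [vecNorm_one]
      gcongr
      simpa using Finset.sum_sq_le_sq_sum_of_nonneg (s := Finset.univ) (f := fun i => |x i|)
        (fun i _ => abs_nonneg _)
  · refine ⟨1, by positivity, fun x => ?_, fun x => ?_⟩
    · rw [vecNorm_two_sq, one_mul]
    · rw [vecNorm_two_sq]
      have := Finset.sum_nonneg fun (i : Fin d) (_ : i ∈ Finset.univ) => sq_nonneg (x i)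
      gcongr
  · refine ⟨1, by positivity, fun x => ?_, fun x => ?_⟩
    · have h0 := Finset.sum_nonneg fun (i : Fin d) (_ : i ∈ Finset.univ) => sq_nonneg (x i)
      rw [one_mul, ← Real.sq_sqrt h0]
      refine pow_le_pow_left₀ (vecNorm_nonneg (by simp) _) ?_ 2
      refine vecNorm_top_le (Real.sqrt_nonneg _) fun i => Real.abs_le_sqrt ?_
      exact Finset.single_le_sum (f := fun i => x i ^ 2) (fun i _ => sq_nonneg (x i))
        (Finset.mem_univ i)
    · rw [one_mul]
      calc ∑ i, x i ^ 2 ≤ ∑ _i : Fin d, vecNorm ∞ x ^ 2 := by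
            refine Finset.sum_le_sum fun i _ => sq_le_sq.2 ?_
            exact (abs_le_vecNorm_top x i).trans (le_abs_self _)
        _ = d * vecNorm ∞ x ^ 2 := by simp

lemma vecNorm_sub_mean_le (hp : p = 1 ∨ p = 2 ∨ p = ∞) {n : ℕ} (hn : 0 < n) {y : ℝ}
    {x : Fin n → Fin d → ℝ} (hx : ∀ u v, vecNorm p (x u - x v) ≤ y) (v : Fin n) :
    vecNorm p (x v - mean x) ≤ y := by
  have hn' : (0 : ℝ) < n := by exact_mod_cast hn
  have h : x v - mean x = (n : ℝ)⁻¹ • ∑ u, (x v - x u) := by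
    rw [mean, Finset.sum_sub_distrib, smul_sub]
    congr 1
    rw [Finset.sum_const, Finset.card_univ, Fintype.card_fin, ← Nat.cast_smul_eq_nsmul ℝ, smul_smul,
      inv_mul_cancel₀ hn'.ne', one_smul]
  rw [h, vecNorm_smul hp, abs_of_pos (by positivity)]
  calc (n : ℝ)⁻¹ * vecNorm p (∑ u, (x v - x u)) ≤ (n : ℝ)⁻¹ * ∑ _u : Fin n, y := by
        gcongr
        exact (vecNorm_sum_le hp _ _).trans (Finset.sum_le_sum fun u _ => hx v u)
    _ = y := by simp [inv_mul_cancel_left₀ hn'.ne']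

end Norms

/-! ### Sampling machines without replacement -/

section Sampling

variable {n : ℕ}

/-- The uniform distribution on the assignments of `n` machines to `n` roles. -/
abbrev uniformPerm (n : ℕ) : PMF (Equiv.Perm (Fin n)) := PMF.uniformOfFintype _

lemma expect_uniformPerm (f : Equiv.Perm (Fin n) → ℝ) :
    expect (uniformPerm n) f = ((n.factorial : ℝ))⁻¹ * ∑ σ, f σ := by
  simp [expect, Finset.mul_sum, Fintype.card_perm]

lemma expect_uniformPerm_mul_left (π : Equiv.Perm (Fin n)) (f : Equiv.Perm (Fin n) → ℝ) :
    expect (uniformPerm n) (fun σ => f (π * σ)) = expect (uniformPerm n) f := by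
  rw [expect_uniformPerm, expect_uniformPerm]
  congr 1
  exact Equiv.sum_comp (Equiv.mulLeft π) f

lemma expect_perm_apply (w : Fin n → ℝ) (r : Fin n) :
    expect (uniformPerm n) (fun σ => w (σ.symm r)) = (n : ℝ)⁻¹ * ∑ v, w v := by
  have hsym : ∀ s, expect (uniformPerm n) (fun σ => w (σ.symm s)) =
      expect (uniformPerm n) (fun σ => w (σ.symm r)) := by
    intro s
    rw [← expect_uniformPerm_mul_left (Equiv.swap r s)]
    congr 1
    funext σ
    change w (σ.symm ((Equiv.swap r s).symm s)) = _
    simp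
  have hn : (0 : ℝ) < n := by exact_mod_cast r.pos
  have hsum : ∑ s, expect (uniformPerm n) (fun σ => w (σ.symm s)) = ∑ v, w v := by
    rw [← expect_sum, ← expect_const (uniformPerm n) (∑ v, w v)]
    congr 1
    funext σ
    exact Equiv.sum_comp σ.symm w
  rw [Finset.sum_congr rfl fun s _ => hsym s] at hsum
  rw [← hsum]
  simp [inv_mul_cancel_left₀ hn.ne']

/-- Two different samples without replacement of a centred population are negatively
correlated. -/
lemma expect_perm_mul_nonpos {w : Fin n → ℝ} (hw : ∑ v, w v = 0) {r s : Fin n} (hrs : r ≠ s) :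
    expect (uniformPerm n) (fun σ => w (σ.symm r) * w (σ.symm s)) ≤ 0 := by
  set c := fun s => expect (uniformPerm n) (fun σ => w (σ.symm r) * w (σ.symm s)) with hc
  have hsym : ∀ t, t ≠ r → c t = c s := by
    intro t ht
    simp only [hc]
    rw [← expect_uniformPerm_mul_left (Equiv.swap s t)]
    congr 1
    funext σ
    change w (σ.symm ((Equiv.swap s t).symm r)) * w (σ.symm ((Equiv.swap s t).symm t)) = _
    rw [Equiv.symm_swap, Equiv.swap_apply_of_ne_of_ne hrs ht.symm, Equiv.swap_apply_right]
  have hsum : ∑ t, c t = 0 := by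
    simp only [hc]
    rw [← expect_sum, ← expect_const (uniformPerm n) 0]
    congr 1
    funext σ
    rw [← Finset.mul_sum, Equiv.sum_comp σ.symm w, hw, mul_zero]
  have hr : 0 ≤ c r := by
    rw [← expect_const (uniformPerm n) 0]
    exact expect_mono fun σ _ => mul_self_nonneg _
  rw [← Finset.add_sum_erase _ _ (Finset.mem_univ r),
    Finset.sum_congr rfl fun t ht => hsym t (Finset.ne_of_mem_erase ht), Finset.sum_const,
    nsmul_eq_mul] at hsum
  have hpos : 0 < (Finset.univ.erase r).card :=
    Finset.card_pos.2 ⟨s, by simp [hrs.symm]⟩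
  have hpos' : (0 : ℝ) < ((Finset.univ.erase r).card : ℝ) := by exact_mod_cast hpos
  change c s ≤ 0
  nlinarith

lemma expect_perm_sum_sq_le {w : Fin n → ℝ} (hw : ∑ v, w v = 0) (T : Finset (Fin n)) :
    expect (uniformPerm n) (fun σ => (∑ r ∈ T, w (σ.symm r)) ^ 2) ≤
      T.card * ((n : ℝ)⁻¹ * ∑ v, w v ^ 2) := by
  simp only [sq, Finset.sum_mul_sum]
  rw [expect_sum, ← nsmul_eq_mul, ← Finset.sum_const]
  refine Finset.sum_le_sum fun r hr => ?_
  rw [expect_sum, ← Finset.add_sum_erase _ _ hr]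
  have h1 := expect_perm_apply (fun v => w v * w v) r
  have h2 : ∑ s ∈ T.erase r, expect (uniformPerm n) (fun σ => w (σ.symm r) * w (σ.symm s)) ≤ 0 :=
    Finset.sum_nonpos fun s hs => expect_perm_mul_nonpos hw (Finset.ne_of_mem_erase hs).symm
  linarith

/-- The mean of the vectors held in the first `m` roles. -/
def sampleMean {d : ℕ} (m : ℕ) (z : Fin n → Fin d → ℝ) : Fin d → ℝ :=
  fun i => (m : ℝ)⁻¹ * ∑ r ∈ Finset.univ.filter (fun r : Fin n => (r : ℕ) < m), z r i

lemma card_filter_val_lt {m : ℕ} (hm : m ≤ n) :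
    (Finset.univ.filter fun r : Fin n => (r : ℕ) < m).card = m := by
  rw [Fin.card_filter_val_lt, min_eq_right hm]

lemma mean_apply {d : ℕ} (x : Fin n → Fin d → ℝ) (i : Fin d) :
    mean x i = (n : ℝ)⁻¹ * ∑ v, x v i := by
  simp [mean, Finset.sum_apply]

lemma expect_sampleMean {d m : ℕ} (hm : 0 < m) (hmn : m ≤ n) (x : Fin n → Fin d → ℝ) (i : Fin d) :
    expect (uniformPerm n) (fun σ => sampleMean m (fun r => x (σ.symm r)) i) = mean x i := by
  have hm' : (0 : ℝ) < m := by exact_mod_cast hm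
  simp only [sampleMean]
  rw [expect_const_mul, expect_sum, Finset.sum_congr rfl fun r _ =>
    expect_perm_apply (fun v => x v i) r, Finset.sum_const, card_filter_val_lt hmn, nsmul_eq_mul,
    inv_mul_cancel_left₀ hm'.ne', mean_apply]

lemma sampleMean_sub_mean {d m : ℕ} (hm : 0 < m) (hmn : m ≤ n) (x : Fin n → Fin d → ℝ)
    (σ : Equiv.Perm (Fin n)) (i : Fin d) :
    sampleMean m (fun r => x (σ.symm r)) i - mean x i =
      (m : ℝ)⁻¹ * ∑ r ∈ Finset.univ.filter (fun r : Fin n => (r : ℕ) < m),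
        (x (σ.symm r) i - mean x i) := by
  have hm' : (0 : ℝ) < m := by exact_mod_cast hm
  rw [Finset.sum_sub_distrib, Finset.sum_const, card_filter_val_lt hmn, nsmul_eq_mul, mul_sub,
    inv_mul_cancel_left₀ hm'.ne', sampleMean]

/-- With `min n (d * Q)` sampled machines the sampling error is small enough for each of the three
norms; it vanishes if all machines are sampled. -/
lemma expect_sampling_error_le {p : ℝ≥0∞} (hp : p = 1 ∨ p = 2 ∨ p = ∞) {d Q : ℕ} (hn : 0 < n)
    (hd : 0 < d) (hQ : 0 < Q) {y : ℝ} {x : Fin n → Fin d → ℝ}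
    (hx : ∀ u v, vecNorm p (x u - x v) ≤ y) :
    expect (uniformPerm n) (fun σ =>
      vecNorm p (sampleMean (min n (d * Q)) (fun r => x (σ.symm r)) - mean x) ^ 2) ≤
        y ^ 2 / Q := by
  have hn' : (0 : ℝ) < n := by exact_mod_cast hn
  have hd' : (0 : ℝ) < d := by exact_mod_cast hd
  have hQ' : (0 : ℝ) < Q := by exact_mod_cast hQ
  have hcent : ∀ i, ∑ v, (x v i - mean x i) = 0 := by
    intro i
    rw [Finset.sum_sub_distrib, mean_apply]
    simp [mul_inv_cancel_left₀ hn'.ne']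
  rcases le_total n (d * Q) with hc | hc
  · rw [min_eq_left hc]
    have h0 : ∀ σ : Equiv.Perm (Fin n), sampleMean n (fun r => x (σ.symm r)) - mean x = 0 := by
      intro σ
      funext i
      rw [Pi.sub_apply, sampleMean_sub_mean hn le_rfl]
      simp only [Fin.is_lt, Finset.filter_true]
      rw [Equiv.sum_comp σ.symm (fun v => x v i - mean x i), hcent]
      simp
    simp only [h0, vecNorm_zero hp]
    rw [expect_const, zero_pow two_ne_zero]
    positivity
  · rw [min_eq_right hc]
    set m := d * Q with hm
    have hm0 : 0 < m := Nat.mul_pos hd hQ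
    have hm' : (0 : ℝ) < m := by exact_mod_cast hm0
    obtain ⟨κ, hκ, h1, h2⟩ := exists_vecNorm_sq_comparison hp hd
    have hy : ∀ v, vecNorm p (x v - mean x) ^ 2 ≤ y ^ 2 := fun v =>
      pow_le_pow_left₀ (vecNorm_nonneg hp _) (vecNorm_sub_mean_le hp hn hx v) 2
    have hcoord : ∀ i, expect (uniformPerm n) (fun σ =>
        (sampleMean m (fun r => x (σ.symm r)) i - mean x i) ^ 2) ≤
          (m : ℝ)⁻¹ * ((n : ℝ)⁻¹ * ∑ v, (x v i - mean x i) ^ 2) := by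
      intro i
      simp only [sampleMean_sub_mean hm0 hc, mul_pow]
      rw [expect_const_mul]
      have := expect_perm_sum_sq_le (hcent i) (Finset.univ.filter fun r : Fin n => (r : ℕ) < m)
      rw [card_filter_val_lt hc] at this
      refine (mul_le_mul_of_nonneg_left this (by positivity)).trans (le_of_eq ?_)
      field_simp
    calc expect (uniformPerm n) (fun σ =>
          vecNorm p (sampleMean m (fun r => x (σ.symm r)) - mean x) ^ 2)
        ≤ expect (uniformPerm n) (fun σ =>
          κ * ∑ i, (sampleMean m (fun r => x (σ.symm r)) i - mean x i) ^ 2) :=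
          expect_mono fun σ _ => h1 _
      _ ≤ κ * ∑ i, (m : ℝ)⁻¹ * ((n : ℝ)⁻¹ * ∑ v, (x v i - mean x i) ^ 2) := by
          rw [expect_const_mul, expect_sum]
          exact mul_le_mul_of_nonneg_left (Finset.sum_le_sum fun i _ => hcoord i) hκ
      _ = (m : ℝ)⁻¹ * ((n : ℝ)⁻¹ * ∑ v, κ * ∑ i, (x v i - mean x i) ^ 2) := by
          rw [← Finset.mul_sum, ← Finset.mul_sum, Finset.sum_comm, ← Finset.mul_sum]
          ring
      _ ≤ (m : ℝ)⁻¹ * ((n : ℝ)⁻¹ * ∑ _v : Fin n, d * y ^ 2) := by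
          refine mul_le_mul_of_nonneg_left (mul_le_mul_of_nonneg_left
            (Finset.sum_le_sum fun v _ => ?_) (by positivity)) (by positivity)
          exact (h2 (x v - mean x)).trans (mul_le_mul_of_nonneg_left (hy v) hd'.le)
      _ = y ^ 2 / Q := by
          rw [hm]
          push_cast
          simp only [Finset.sum_const, Finset.card_univ, Fintype.card_fin, nsmul_eq_mul]
          field_simp

end Sampling

namespace Protocol

variable {n d : ℕ} (P : Protocol n d)

lemma expect_law (y : ℝ) (x : Fin n → Fin d → ℝ) (f : P.Outcome → ℝ) :
    expect (P.law y x) f = expect (uniformPerm n) fun σ =>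
      expect (P.transcriptLaw y (fun r => x (σ.symm r)) P.steps) fun τ => f (σ, τ) := by
  rw [law, expect_bind]
  simp only [expect_map]

/-- If, for each assignment of the machines to the roles, the roles agree on an unbiased estimate
of the mean of the sample, then the machines solve the mean estimation problem, and the errors of
sampling and of estimation add up. -/
lemma estimatesMean_of_sampleMean {p : ℝ≥0∞} (hp : p = 1 ∨ p = 2 ∨ p = ∞) {m : ℕ} (hm : 0 < m)
    (hmn : m ≤ n) {y : ℝ} {x : Fin n → Fin d → ℝ} {A S : ℝ}
    (hS : expect (uniformPerm n) (fun σ =>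
      vecNorm p (sampleMean m (fun r => x (σ.symm r)) - mean x) ^ 2) ≤ S)
    (h : ∀ σ : Equiv.Perm (Fin n), ∃ est : P.Transcript → Fin d → ℝ,
      (∀ τ ∈ (P.transcriptLaw y (fun r => x (σ.symm r)) P.steps).support, ∀ r,
        P.output r y (x (σ.symm r)) (P.view r P.steps τ) = est τ) ∧
      (∀ i, expect (P.transcriptLaw y (fun r => x (σ.symm r)) P.steps) (fun τ => est τ i) =
        sampleMean m (fun r => x (σ.symm r)) i) ∧
      expect (P.transcriptLaw y (fun r => x (σ.symm r)) P.steps) (fun τ =>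
        vecNorm p (est τ - sampleMean m (fun r => x (σ.symm r))) ^ 2) ≤ A) :
    P.EstimatesMean p y x (2 * A + 2 * S) := by
  choose est hout hmean hA using h
  have hexp : P.expVec y x (fun ω => est ω.1 ω.2) = mean x := by
    funext i
    have h1 : P.expVec y x (fun ω => est ω.1 ω.2) i =
        expect (P.law y x) (fun ω => est ω.1 ω.2 i) := by
      simp [expVec, expect, Finset.sum_apply]
    rw [h1, expect_law, ← expect_sampleMean hm hmn x i]
    simp only [hmean]
  refine ⟨fun ω => est ω.1 ω.2, fun ω hω v => ?_, hexp, ?_⟩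
  · rw [law, PMF.mem_support_bind_iff] at hω
    obtain ⟨σ, -, hω⟩ := hω
    rw [PMF.mem_support_map_iff] at hω
    obtain ⟨τ, hτ, rfl⟩ := hω
    have := hout σ τ hτ (σ v)
    rw [Equiv.symm_apply_apply] at this
    exact this
  · have h1 : P.variance p y x (fun ω => est ω.1 ω.2) =
        expect (P.law y x) (fun ω => vecNorm p (est ω.1 ω.2 - mean x) ^ 2) := by
      rw [variance, hexp, expect]
    rw [h1, expect_law]
    calc _ ≤ expect (uniformPerm n) (fun σ => 2 * A +
          2 * vecNorm p (sampleMean m (fun r => x (σ.symm r)) - mean x) ^ 2) := by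
          refine expect_mono fun σ _ => ?_
          calc _ ≤ expect (P.transcriptLaw y (fun r => x (σ.symm r)) P.steps) (fun τ =>
                2 * vecNorm p (est σ τ - sampleMean m (fun r => x (σ.symm r))) ^ 2 +
                2 * vecNorm p (sampleMean m (fun r => x (σ.symm r)) - mean x) ^ 2) := by
                refine expect_mono fun τ _ => ?_
                have h3 := vecNorm_add_le hp (est σ τ - sampleMean m (fun r => x (σ.symm r)))
                  (sampleMean m (fun r => x (σ.symm r)) - mean x)
                rw [sub_add_sub_cancel] at h3
                have h4 := vecNorm_nonneg hp (est σ τ - mean x)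
                refine (pow_le_pow_left₀ h4 h3 2).trans ?_
                nlinarith [sq_nonneg (vecNorm p (est σ τ - sampleMean m (fun r => x (σ.symm r))) -
                  vecNorm p (sampleMean m (fun r => x (σ.symm r)) - mean x))]
            _ ≤ _ := by
                rw [expect_add, expect_const_mul, expect_const]
                have := hA σ
                linarith
      _ ≤ 2 * A + 2 * S := by
          rw [expect_add, expect_const, expect_const_mul]
          linarith

end Protocol

/-! ### Integer vectors of bounded `ℓ_1` norm and codes -/

section Codes

/-- The integer vectors of `ℓ_1` norm at most `R`. -/
def intBall (d R : ℕ) : Finset (Fin d → ℤ) :=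
  (Fintype.piFinset fun _ => Finset.Icc (-(R : ℤ)) R).filter fun k => ∑ i, |k i| ≤ R

lemma mem_intBall {d R : ℕ} {k : Fin d → ℤ} : k ∈ intBall d R ↔ ∑ i, |k i| ≤ R := by
  rw [intBall, Finset.mem_filter, and_iff_right_iff_imp]
  intro h
  rw [Fintype.mem_piFinset]
  intro i
  rw [Finset.mem_Icc, ← abs_le]
  exact (Finset.single_le_sum (f := fun i => |k i|) (fun i _ => abs_nonneg _)
    (Finset.mem_univ i)).trans h

lemma sum_geometric_natAbs {M : ℕ} {ρ : ℝ} (hρ : ρ * (M + 1) = M) (R : ℕ) :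
    ∑ j ∈ Finset.Icc (-(R : ℤ)) R, ρ ^ j.natAbs = 1 + 2 * M - 2 * M * ρ ^ R := by
  induction R with
  | zero => simp
  | succ R ih =>
    have h : Finset.Icc (-((R + 1 : ℕ) : ℤ)) ((R + 1 : ℕ) : ℤ) =
        insert (-((R + 1 : ℕ) : ℤ)) (insert ((R + 1 : ℕ) : ℤ) (Finset.Icc (-(R : ℤ)) R)) := by
      ext j
      simp only [Finset.mem_Icc, Finset.mem_insert]
      omega
    rw [h, Finset.sum_insert, Finset.sum_insert, ih, Int.natAbs_neg, Int.natAbs_natCast, pow_succ]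
    · linear_combination 2 * ρ ^ R * hρ
    · simp
    · simp only [Finset.mem_Icc, Finset.mem_insert]
      omega

/-- An `ℓ_1` ball of radius proportional to `d` has only exponentially many integer points. The
points are counted with the weight `ρ ^ ‖k‖₁`, where `ρ = M / (M + 1)`: it is at least
`ρ ^ (M d) ≥ 3⁻ᵈ` on the ball, and its sum over the whole lattice is a product of geometric
series. -/
lemma card_intBall_le {d M : ℕ} (hM : 0 < M) :
    (intBall d (M * d)).card ≤ (3 * (2 * M + 1)) ^ d := by
  have hM' : (0 : ℝ) < M := by exact_mod_cast hM
  set ρ : ℝ := M / (M + 1) with hρ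
  have hρ0 : 0 < ρ := by positivity
  have hρ1 : ρ ≤ 1 := by
    rw [hρ, div_le_one (by positivity)]
    linarith
  have hρM : ρ * (M + 1) = M := by
    rw [hρ]
    field_simp
  have h3 : 1 ≤ 3 * ρ ^ M := by
    have h1 : ρ⁻¹ ≤ Real.exp (M : ℝ)⁻¹ := by
      refine le_trans (le_of_eq ?_) (Real.add_one_le_exp _)
      rw [hρ]
      field_simp
      ring
    have h2 : ρ⁻¹ ^ M ≤ 3 := by
      refine (pow_le_pow_left₀ (by positivity) h1 M).trans ?_
      rw [← Real.exp_nat_mul, mul_inv_cancel₀ hM'.ne']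
      exact Real.exp_one_lt_three.le
    rw [inv_pow, inv_le_iff_one_le_mul₀ (by positivity)] at h2
    linarith
  have key : ((intBall d (M * d)).card : ℝ) ≤ (3 * (2 * M + 1)) ^ d := by
    calc ((intBall d (M * d)).card : ℝ) = ∑ _k ∈ intBall d (M * d), 1 := by simp
      _ ≤ ∑ k ∈ intBall d (M * d), 3 ^ d * ∏ i, ρ ^ (k i).natAbs := by
          refine Finset.sum_le_sum fun k hk => ?_
          rw [mem_intBall] at hk
          have hk' : ∑ i, (k i).natAbs ≤ M * d := by
            zify
            exact_mod_cast hk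
          rw [Finset.prod_pow_eq_pow_sum]
          calc (1 : ℝ) ≤ (3 * ρ ^ M) ^ d := one_le_pow₀ h3
            _ = 3 ^ d * ρ ^ (M * d) := by rw [mul_pow, pow_mul]
            _ ≤ _ := mul_le_mul_of_nonneg_left (pow_le_pow_of_le_one hρ0.le hρ1 hk') (by positivity)
      _ ≤ ∑ k ∈ Fintype.piFinset fun _ : Fin d => Finset.Icc (-((M * d : ℕ) : ℤ)) (M * d : ℕ),
            3 ^ d * ∏ i, ρ ^ (k i).natAbs :=
          Finset.sum_le_sum_of_subset_of_nonneg (Finset.filter_subset _ _)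
            fun k _ _ => by positivity
      _ = 3 ^ d * (1 + 2 * M - 2 * M * ρ ^ (M * d)) ^ d := by
          rw [← Finset.mul_sum, ← Finset.prod_univ_sum
            (fun _ : Fin d => Finset.Icc (-((M * d : ℕ) : ℤ)) (M * d : ℕ))
            (fun _ j => ρ ^ j.natAbs), Finset.prod_const, sum_geometric_natAbs hρM]
          simp
      _ ≤ 3 ^ d * (2 * M + 1) ^ d := by
          have h0 : 0 ≤ 1 + 2 * M - 2 * M * ρ ^ (M * d) := by
            rw [← sum_geometric_natAbs hρM]
            positivity
          have h1 : 0 ≤ 2 * M * ρ ^ (M * d) := by positivity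
          refine mul_le_mul_of_nonneg_left (pow_le_pow_left₀ h0 ?_ d) (by positivity)
          linarith
      _ = _ := by rw [mul_pow]
  exact_mod_cast key

/-- Greedy colouring: points of a countable group whose difference lies in a finite symmetric set
`B` get different colours as soon as there are `|B|` colours. -/
lemma exists_colouring {V C : Type*} [AddGroup V] [Encodable V] [DecidableEq V] [Fintype C]
    [DecidableEq C] (B : Finset V) (h0 : 0 ∈ B) (hneg : ∀ b ∈ B, -b ∈ B)
    (hC : B.card ≤ Fintype.card C) :
    ∃ col : V → C, ∀ a b, a - b ∈ B → col a = col b → a = b := by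
  classical
  have hCpos : 0 < Fintype.card C := (Finset.card_pos.2 ⟨0, h0⟩).trans_le hC
  have : Nonempty C := Fintype.card_pos_iff.1 hCpos
  have wf : WellFounded fun a b : V => Encodable.encode a < Encodable.encode b :=
    InvImage.wf _ wellFounded_lt
  let F : (a : V) → ((b : V) → Encodable.encode b < Encodable.encode a → C) → C := fun a ih =>
    Classical.epsilon fun c => ∀ b (hb : Encodable.encode b < Encodable.encode a),
      a - b ∈ B → ih b hb ≠ c
  have hcol : ∀ a b, Encodable.encode b < Encodable.encode a → a - b ∈ B →
      wf.fix F b ≠ wf.fix F a := by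
    intro a b hb hab
    have hex : ∃ c, ∀ b, Encodable.encode b < Encodable.encode a →
        a - b ∈ B → wf.fix F b ≠ c := by
      set used := (B.erase 0).image fun e => wf.fix F (-e + a)
      have hused : used.card < Fintype.card C := by
        refine lt_of_le_of_lt Finset.card_image_le ?_
        rw [Finset.card_erase_of_mem h0]
        omega
      obtain ⟨c, hc⟩ : ∃ c, c ∉ used := by
        by_contra! h
        rw [Finset.eq_univ_of_forall h, Finset.card_univ] at hused
        exact lt_irrefl _ hused
      refine ⟨c, fun b hb hab hbc => hc (Finset.mem_image.2 ⟨a - b, ?_, ?_⟩)⟩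
      · refine Finset.mem_erase.2 ⟨fun h => ?_, hab⟩
        rw [sub_eq_zero.1 h] at hb
        exact lt_irrefl _ hb
      · rw [← hbc, neg_sub, sub_add_cancel]
    rw [wf.fix_eq F a]
    exact Classical.epsilon_spec hex b hb hab
  refine ⟨wf.fix F, fun a b hab h => ?_⟩
  by_contra hne
  rcases lt_trichotomy (Encodable.encode a) (Encodable.encode b) with hlt | heq | hlt
  · exact hcol b a hlt (by simpa using hneg _ hab) h
  · exact hne (Encodable.encode_injective heq)
  · exact hcol a b hlt hab h.symm

/-- A code for pairs `(a, K)` of integer vectors by few bits, from which `K` can be recovered if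
its `ℓ_1` norm is at most `M d`, and `a` if it is known up to an error of `ℓ_1` norm `2 d`. -/
lemma exists_pair_code {d M L : ℕ} (hM : 0 < M) (hL : (27 * (3 * (2 * M + 1))) ^ d ≤ 2 ^ L) :
    ∃ E : (Fin d → ℤ) × (Fin d → ℤ) → (Fin L → Bool), ∀ s s', E s = E s' →
      ∑ i, |s.1 i - s'.1 i| ≤ 4 * d → ∑ i, |s.2 i| ≤ M * d → ∑ i, |s'.2 i| ≤ M * d → s = s' := by
  classical
  obtain ⟨col, hcol⟩ := exists_colouring (C := intBall d (4 * d)) (intBall d (4 * d))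
    (by rw [mem_intBall]; simp) (fun b hb => by simpa [mem_intBall] using hb) (by simp)
  have h0 : (0 : Fin d → ℤ) ∈ intBall d (M * d) := by
    rw [mem_intBall]
    simp only [Pi.zero_apply, abs_zero, Finset.sum_const_zero]
    positivity
  have hcard : Fintype.card (intBall d (4 * d) × intBall d (M * d)) ≤
      Fintype.card (Fin L → Bool) := by
    rw [Fintype.card_prod, Fintype.card_coe, Fintype.card_coe, Fintype.card_fun, Fintype.card_bool,
      Fintype.card_fin]
    refine le_trans ?_ hL
    rw [mul_pow]
    exact Nat.mul_le_mul (card_intBall_le (by norm_num)) (card_intBall_le hM)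
  obtain ⟨e⟩ := Function.Embedding.nonempty_of_card_le hcard
  refine ⟨fun s => e (col s.1, if h : s.2 ∈ intBall d (M * d) then ⟨s.2, h⟩ else ⟨0, h0⟩),
    fun s s' h h1 h2 h3 => ?_⟩
  have h2' : s.2 ∈ intBall d (M * d) := by rw [mem_intBall]; exact_mod_cast h2
  have h3' : s'.2 ∈ intBall d (M * d) := by rw [mem_intBall]; exact_mod_cast h3
  have h4 := e.injective h
  rw [dif_pos h2', dif_pos h3', Prod.mk.injEq] at h4
  refine Prod.ext (hcol _ _ ?_ h4.1) (Subtype.mk.inj h4.2)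
  rw [mem_intBall]
  exact_mod_cast h1

/-- A code for integers by `ℓ` bits that distinguishes integers at distance less than `2 ^ ℓ`. -/
lemma exists_int_code (ℓ : ℕ) :
    ∃ E : ℤ → (Fin ℓ → Bool), ∀ a b, E a = E b → |a - b| < 2 ^ ℓ → a = b := by
  have hcard : Fintype.card (ZMod (2 ^ ℓ)) = Fintype.card (Fin ℓ → Bool) := by
    simp [ZMod.card]
  refine ⟨fun a => Fintype.equivOfCardEq hcard (a : ZMod (2 ^ ℓ)), fun a b h hab => ?_⟩
  have h1 := (Fintype.equivOfCardEq hcard).injective h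
  rw [ZMod.intCast_eq_intCast_iff_dvd_sub] at h1
  have h2 : b - a = 0 := Int.eq_zero_of_abs_lt_dvd h1 (by
    rw [abs_sub_comm]
    exact_mod_cast hab)
  linarith

end Codes

/-! ### Unbiased roundings -/

section Rounding

/-- `x` is rounded up or down at random to an integer `a` of mean `x`, and `φ a` is returned. -/
def randomRound {β : Type*} (x : ℝ) (φ : ℤ → β) : PMF β :=
  (PMF.ofFintype (fun b : Bool => ENNReal.ofReal (if b then Int.fract x else 1 - Int.fract x)) (by
    simp [← ENNReal.ofReal_add (Int.fract_nonneg x) (sub_nonneg.2 (Int.fract_lt_one x).le)])).map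
    fun b => φ (⌊x⌋ + if b then 1 else 0)

lemma exists_of_mem_support_randomRound {β : Type*} {x : ℝ} {φ : ℤ → β} {b : β}
    (hb : b ∈ (randomRound x φ).support) : ∃ a : ℤ, b = φ a ∧ |a - x| ≤ 1 := by
  rw [randomRound, PMF.mem_support_map_iff] at hb
  obtain ⟨c, -, rfl⟩ := hb
  refine ⟨_, rfl, ?_⟩
  have h1 := Int.floor_le x
  have h2 := Int.lt_floor_add_one x
  rw [abs_le]
  cases c <;> constructor <;> simp <;> linarith

lemma expect_randomRound {β : Type*} [Fintype β] {x : ℝ} {φ : ℤ → β} {f : β → ℝ} {c : ℝ}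
    (h : ∀ a : ℤ, |a - x| ≤ 1 → f (φ a) = a + c) : expect (randomRound x φ) f = x + c := by
  have h1 := Int.floor_le x
  have h2 := Int.lt_floor_add_one x
  have h3 := h ⌊x⌋ (by rw [abs_le]; constructor <;> linarith)
  have h4 := h (⌊x⌋ + 1) (by push_cast; rw [abs_le]; constructor <;> linarith)
  rw [randomRound, expect_map, expect, Fintype.sum_bool]
  simp only [PMF.ofFintype_apply, if_true, Bool.false_eq_true, if_false, add_zero, h3, h4,
    ENNReal.toReal_ofReal (Int.fract_nonneg x),
    ENNReal.toReal_ofReal (sub_nonneg.2 (Int.fract_lt_one x).le)]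
  rw [Int.fract]
  push_cast
  ring

/-- A random signed unit vector or zero, encoded as an optional coordinate: `some i` has
probability `|w i|`. It is defined for `∑ i, |w i| ≤ 1`, and put to `none` otherwise. -/
def sparsePMF {d : ℕ} (w : Fin d → ℝ) : PMF (Option (Fin d)) :=
  if h : ∑ i, |w i| ≤ 1 then
    PMF.ofFintype (fun o => ENNReal.ofReal (o.elim (1 - ∑ i, |w i|) fun i => |w i|)) (by
      simp only [Fintype.sum_option, Option.elim_none, Option.elim_some]
      rw [← ENNReal.ofReal_sum_of_nonneg fun i _ => abs_nonneg _,
        ← ENNReal.ofReal_add (by simpa using h) (Finset.sum_nonneg fun i _ => abs_nonneg _)]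
      simp)
  else PMF.pure none

/-- The signed unit vector (or zero) that is encoded by an optional coordinate. -/
def sparseVec {d : ℕ} (w : Fin d → ℝ) (o : Option (Fin d)) : Fin d → ℤ :=
  fun i => if o = some i then (if 0 ≤ w i then 1 else -1) else 0

lemma sum_abs_sparseVec_le {d : ℕ} (w : Fin d → ℝ) (o : Option (Fin d)) :
    ∑ i, |sparseVec w o i| ≤ 1 := by
  cases o with
  | none => simp [sparseVec]
  | some j =>
    rw [Finset.sum_eq_single j]
    · simp only [sparseVec, if_true]
      split_ifs <;> simp
    · intro i _ hi
      simp [sparseVec, hi.symm]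
    · simp

lemma expect_sparsePMF {d : ℕ} {w : Fin d → ℝ} (hw : ∑ i, |w i| ≤ 1) (i : Fin d) (φ : ℝ → ℝ)
    (hφ : φ 0 = 0) : expect (sparsePMF w) (fun o => φ (sparseVec w o i)) =
      |w i| * φ (if 0 ≤ w i then 1 else -1) := by
  rw [sparsePMF, dif_pos hw, expect, Finset.sum_eq_single (some i)]
  · simp only [PMF.ofFintype_apply, Option.elim_some, sparseVec, if_true]
    rw [ENNReal.toReal_ofReal (abs_nonneg _)]
    split_ifs <;> simp
  · intro o _ ho
    simp [sparseVec, ho, hφ]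
  · simp

lemma expect_sparseVec {d : ℕ} {w : Fin d → ℝ} (hw : ∑ i, |w i| ≤ 1) (i : Fin d) :
    expect (sparsePMF w) (fun o => (sparseVec w o i : ℝ)) = w i := by
  rw [expect_sparsePMF hw i (fun t => t) rfl]
  split_ifs with h
  · rw [abs_of_nonneg h, mul_one]
  · rw [abs_of_neg (not_le.1 h)]
    ring

lemma expect_sparseVec_sq {d : ℕ} {w : Fin d → ℝ} (hw : ∑ i, |w i| ≤ 1) (i : Fin d) :
    expect (sparsePMF w) (fun o => (sparseVec w o i : ℝ) ^ 2) = |w i| := by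
  rw [expect_sparsePMF hw i (fun t => t ^ 2) (by simp)]
  split_ifs <;> simp

/-- The law of `r` independent samples. -/
def iidPMF {α : Type*} (μ : PMF α) : (r : ℕ) → PMF (Fin r → α)
  | 0 => PMF.pure Fin.elim0
  | r + 1 => μ.bind fun a => (iidPMF μ r).map fun f => Fin.cons a f

lemma expect_iidPMF_succ {α : Type*} [Fintype α] (μ : PMF α) (r : ℕ) (h : (Fin (r + 1) → α) → ℝ) :
    expect (iidPMF μ (r + 1)) h =
      expect μ fun a => expect (iidPMF μ r) fun f => h (Fin.cons a f) := by
  rw [iidPMF, expect_bind]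
  simp only [expect_map]

lemma expect_iidPMF_sum {α : Type*} [Fintype α] (μ : PMF α) (r : ℕ) (φ : α → ℝ) :
    expect (iidPMF μ r) (fun f => ∑ j, φ (f j)) = r * expect μ φ := by
  induction r with
  | zero => simp [expect_const]
  | succ r ih =>
    rw [expect_iidPMF_succ]
    simp only [Fin.sum_univ_succ, Fin.cons_zero, Fin.cons_succ, expect_add, expect_const, ih]
    push_cast
    ring

lemma expect_iidPMF_sum_sq {α : Type*} [Fintype α] (μ : PMF α) (r : ℕ) {φ : α → ℝ}
    (hφ : expect μ φ = 0) :
    expect (iidPMF μ r) (fun f => (∑ j, φ (f j)) ^ 2) = r * expect μ fun a => φ a ^ 2 := by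
  induction r with
  | zero => simp [expect_const]
  | succ r ih =>
    rw [expect_iidPMF_succ]
    simp only [Fin.sum_univ_succ, Fin.cons_zero, Fin.cons_succ, add_sq, expect_add, expect_const,
      expect_const_mul, ih, expect_iidPMF_sum, hφ, mul_zero]
    push_cast
    ring

/-- The sum of `r` sparse samples. -/
def sparseSum {d : ℕ} (w : Fin d → ℝ) {r : ℕ} (f : Fin r → Option (Fin d)) : Fin d → ℤ :=
  fun i => ∑ j, sparseVec w (f j) i

lemma sum_abs_sparseSum_le {d : ℕ} (w : Fin d → ℝ) {r : ℕ} (f : Fin r → Option (Fin d)) :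
    ∑ i, |sparseSum w f i| ≤ r := by
  calc ∑ i, |sparseSum w f i| ≤ ∑ i, ∑ j, |sparseVec w (f j) i| :=
        Finset.sum_le_sum fun i _ => Finset.abs_sum_le_sum_abs _ _
    _ = ∑ j, ∑ i, |sparseVec w (f j) i| := Finset.sum_comm
    _ ≤ ∑ _j : Fin r, 1 := Finset.sum_le_sum fun j _ => sum_abs_sparseVec_le w (f j)
    _ = r := by simp

lemma expect_sparseSum {d : ℕ} {w : Fin d → ℝ} (hw : ∑ i, |w i| ≤ 1) (r : ℕ) (i : Fin d) :
    expect (iidPMF (sparsePMF w) r) (fun f => (sparseSum w f i : ℝ)) = r * w i := by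
  simp only [sparseSum, Int.cast_sum]
  rw [expect_iidPMF_sum (φ := fun o => (sparseVec w o i : ℝ)), expect_sparseVec hw]

lemma expect_sparseSum_sub_sq_le {d : ℕ} {w : Fin d → ℝ} (hw : ∑ i, |w i| ≤ 1) (r : ℕ)
    (i : Fin d) :
    expect (iidPMF (sparsePMF w) r) (fun f => ((sparseSum w f i : ℝ) - r * w i) ^ 2) ≤
      r * |w i| := by
  have h : ∀ f : Fin r → Option (Fin d), (sparseSum w f i : ℝ) - r * w i =
      ∑ j, ((sparseVec w (f j) i : ℝ) - w i) := by
    intro f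
    rw [Finset.sum_sub_distrib, sparseSum]
    simp
  simp only [h]
  rw [expect_iidPMF_sum_sq (φ := fun o => (sparseVec w o i : ℝ) - w i)]
  · refine mul_le_mul_of_nonneg_left ?_ (by positivity)
    have h2 : ∀ o, ((sparseVec w o i : ℝ) - w i) ^ 2 =
        (sparseVec w o i : ℝ) ^ 2 - 2 * w i * sparseVec w o i + w i ^ 2 := fun o => by ring
    simp only [h2]
    rw [expect_add, expect_sub, expect_const_mul, expect_const, expect_sparseVec hw,
      expect_sparseVec_sq hw]
    nlinarith [sq_nonneg (w i)]
  · rw [expect_sub, expect_sparseVec hw, expect_const, sub_self]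

end Rounding

/-! ### The protocol for the `ℓ_1` and `ℓ_2` norms -/

lemma card_filter_add_mod_le (N B s c : ℕ) :
    ((Finset.range N).filter fun i => (i + s) % B = c).card ≤ (N + s) / B + 1 := by
  rw [← Finset.card_range ((N + s) / B + 1)]
  refine Finset.card_le_card_of_injOn (fun i => (i + s) / B) (fun i hi => ?_) fun i hi j hj h => ?_
  · simp only [Finset.coe_filter, Finset.mem_range, Set.mem_ofPred_eq] at hi
    simp only [Finset.coe_range, Set.mem_Iio]
    exact Nat.lt_succ_of_le (Nat.div_le_div_right (by omega))
  · simp only [Finset.coe_filter, Finset.mem_range, Set.mem_ofPred_eq] at hi hj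
    have h1 := Nat.div_add_mod (i + s) B
    have h2 := Nat.div_add_mod (j + s) B
    simp only at h
    rw [hi.2, h] at h1
    rw [hj.2] at h2
    omega

lemma Protocol.view_eq_some {n d : ℕ} (P : Protocol n d) {r : Fin n} {k : ℕ} {τ : P.Transcript}
    {i : Fin P.steps} (hi : (i : ℕ) < k) (h : P.sender i = r ∨ P.receiver i = r) :
    P.view r k τ i = some (τ i) :=
  if_pos ⟨hi, h⟩

/-- The role number `t` in cyclic order. -/
def role {n : ℕ} (hn : 0 < n) (t : ℕ) : Fin n := ⟨t % n, Nat.mod_lt _ hn⟩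

lemma role_val {n : ℕ} (hn : 0 < n) (r : Fin n) : role hn r = r :=
  Fin.ext (Nat.mod_eq_of_lt r.2)

lemma role_add_self {n : ℕ} (hn : 0 < n) (r : Fin n) : role hn (n + r) = r :=
  Fin.ext (by simp [role, Nat.mod_eq_of_lt r.2])

lemma sum_filter_val_lt {n m : ℕ} (hn : 0 < n) (hmn : m ≤ n) (f : Fin n → ℝ) :
    ∑ r ∈ Finset.univ.filter (fun r : Fin n => (r : ℕ) < m), f r =
      ∑ t ∈ Finset.range m, f (role hn t) := by
  refine Finset.sum_nbij' (fun r => (r : ℕ)) (fun t => role hn t) ?_ ?_ ?_ ?_ ?_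
  · intro r hr
    simpa using hr
  · intro t ht
    rw [Finset.mem_range] at ht
    simp only [Finset.mem_filter, Finset.mem_univ, true_and, role]
    rwa [Nat.mod_eq_of_lt (by omega)]
  · intro r _
    exact role_val hn r
  · intro t ht
    rw [Finset.mem_range] at ht
    exact Nat.mod_eq_of_lt (by omega)
  · intro r _
    rw [role_val]

section Ring

variable {d L : ℕ}

/-- The pair `(a, K)` that is encoded by `b`, as recovered with the help of a vector `x` at
`ℓ_1` distance at most `W` from `s • a`. The value is arbitrary if there is no such pair with
`‖K‖₁ ≤ R`. -/
def ringDecode (E : (Fin d → ℤ) × (Fin d → ℤ) → (Fin L → Bool)) (R : ℕ) (s W : ℝ)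
    (x : Fin d → ℝ) (b : Fin L → Bool) : (Fin d → ℤ) × (Fin d → ℤ) :=
  Classical.epsilon fun st => E st = b ∧ ∑ i, |x i - s * st.1 i| ≤ W ∧ ∑ i, |st.2 i| ≤ R

lemma ringDecode_eq {E : (Fin d → ℤ) × (Fin d → ℤ) → (Fin L → Bool)} {R : ℕ}
    (hE : ∀ s s', E s = E s' → ∑ i, |s.1 i - s'.1 i| ≤ 4 * d → ∑ i, |s.2 i| ≤ R →
      ∑ i, |s'.2 i| ≤ R → s = s') {s W : ℝ} (hs : 0 < s) (hW : W ≤ 2 * d * s) {x : Fin d → ℝ}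
    {a K : Fin d → ℤ} (ha : ∑ i, |x i - s * a i| ≤ W) (hK : ∑ i, |K i| ≤ R) :
    ringDecode E R s W x (E (a, K)) = (a, K) := by
  obtain ⟨h1, h2, h3⟩ := Classical.epsilon_spec
    (p := fun st => E st = E (a, K) ∧ ∑ i, |x i - s * st.1 i| ≤ W ∧ ∑ i, |st.2 i| ≤ R)
    ⟨(a, K), rfl, ha, hK⟩
  refine hE _ _ h1 ?_ h3 hK
  have h4 : s * ∑ i, |((ringDecode E R s W x (E (a, K))).1 i : ℝ) - a i| ≤ s * (4 * d) := by
    calc s * ∑ i, |((ringDecode E R s W x (E (a, K))).1 i : ℝ) - a i|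
        ≤ ∑ i, (|x i - s * (ringDecode E R s W x (E (a, K))).1 i| + |x i - s * a i|) := by
          rw [Finset.mul_sum]
          refine Finset.sum_le_sum fun i _ => ?_
          rw [← abs_of_pos hs, ← abs_mul, abs_of_pos hs]
          refine le_trans (le_of_eq ?_) (abs_add_le _ _) |>.trans (le_of_eq
            (congrArg₂ (· + ·) (abs_neg (x i - s * (ringDecode E R s W x (E (a, K))).1 i)) rfl))
          congr 1
          ring
      _ ≤ W + W := by
          rw [Finset.sum_add_distrib]
          exact add_le_add h2 ha
      _ ≤ s * (4 * d) := by linarith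
  have h5 := le_of_mul_le_mul_left h4 hs
  exact_mod_cast h5

/-- The law of message number `t` of the ring protocol, sent by a role with vector `x` that has
received the message `prev`. -/
def ringStep (m r R : ℕ) (c : ℝ) (E : (Fin d → ℤ) × (Fin d → ℤ) → (Fin L → Bool)) (t : ℕ) (y : ℝ)
    (x : Fin d → ℝ) (prev : Fin L → Bool) : PMF (Fin L → Bool) :=
  let s := c * y / d
  let W := 2 * (c * y)
  let st := if t = 0 then (fun i => ⌊x i / s⌋, 0) else ringDecode E R s W x prev
  if t < m then
    (iidPMF (sparsePMF fun i => (x i - s * st.1 i) / W) r).map fun f =>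
      E (st.1, st.2 + sparseSum (fun i => (x i - s * st.1 i) / W) f)
  else PMF.pure prev

/-- The protocol passes a message `2 n` times around the ring of all roles. The message encodes a
pair `(a, K)`: the vector `s • a` is a common reference, obtained by rounding down the vector in
role `0`, and `K` is the sum of the contributions of the roles below `m` that have been passed.
A contribution is a sum of `r` sparse samples of the difference of the own vector and the
reference. Here `c * y` is the bound on the `ℓ_1` distances of the vectors, the reference is
rounded to a grid of width `s = c y / d`, and the differences have `ℓ_1` norm at most
`W = 2 c y`. From step `m` on the message is only copied; role `v` sends it in step `n + v`.
For `y = 0` there is no grid, but then all vectors are equal. -/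
def ringProtocol {n : ℕ} (hn : 0 < n) (m r R : ℕ) (c : ℝ)
    (E : (Fin d → ℤ) × (Fin d → ℤ) → (Fin L → Bool)) : Protocol n d where
  steps := 2 * n
  sender t := role hn t
  receiver t := role hn (t + 1)
  len _ := L
  send t y x v := ringStep m r R c E t y x ((v ⟨t - 1, by omega⟩).getD fun _ => false)
  output t y x v :=
    let st := ringDecode E R (c * y / d) (2 * (c * y)) x
      ((v ⟨n + t, by omega⟩).getD fun _ => false)
    fun i => if y ≤ 0 then x i else c * y / d * st.1 i + 2 * (c * y) / (m * r) * st.2 i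

lemma ringProtocol_bits_le {n : ℕ} (hn : 0 < n) (m r R : ℕ) (c : ℝ)
    (E : (Fin d → ℤ) × (Fin d → ℤ) → (Fin L → Bool)) (v : Fin n) :
    (ringProtocol hn m r R c E).bits v ≤ 7 * L := by
  have h : ∀ s, ∑ t : Fin (2 * n), (if role hn (t + s) = v then L else 0) ≤
      ((2 * n + s) / n + 1) * L := by
    intro s
    rw [Fin.sum_univ_eq_sum_range (fun t => if role hn (t + s) = v then L else 0),
      ← Finset.sum_filter, Finset.sum_const, smul_eq_mul]
    refine Nat.mul_le_mul_right _ (le_trans (le_of_eq ?_)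
      (card_filter_add_mod_le (2 * n) n s v))
    congr 1
    refine Finset.filter_congr fun t _ => ?_
    rw [Fin.ext_iff, role]
  have h0 := h 0
  have h1 := h 1
  have e0 : (2 * n + 0) / n = 2 := by simp [hn.ne']
  have e1 : (2 * n + 1) / n ≤ 3 := by
    rw [Nat.div_le_iff_le_mul_add_pred hn]
    omega
  have h2 : ((2 * n + 1) / n + 1) * L ≤ 4 * L := Nat.mul_le_mul_right _ (by omega)
  rw [e0] at h0
  change (∑ t : Fin (2 * n), if role hn t = v then L else 0) +
    (∑ t : Fin (2 * n), if role hn (t + 1) = v then L else 0) ≤ _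
  simp only [add_zero] at h0
  omega

lemma sum_abs_add_sparseSum_le {t : ℕ} {K w : Fin d → ℤ} {r : ℕ} (hK : ∑ i, |K i| ≤ t * r)
    (hw : ∑ i, |w i| ≤ r) : ∑ i, |(K + w) i| ≤ (t + 1 : ℕ) * r := by
  calc _ ≤ ∑ i, (|K i| + |w i|) := Finset.sum_le_sum fun i _ => abs_add_le _ _
    _ ≤ t * r + r := by
        rw [Finset.sum_add_distrib]
        exact add_le_add hK hw
    _ = _ := by push_cast; ring

section Analysis

variable {n m r R : ℕ} (hn : 0 < n) {c y : ℝ}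
  (E : (Fin d → ℤ) × (Fin d → ℤ) → (Fin L → Bool)) (z : Fin n → Fin d → ℝ)

/-- The message that is received before step `t`, that is, message number `t - 1`. -/
def ringMsg (m r R : ℕ) (c : ℝ) (τ : (ringProtocol hn m r R c E).Transcript) (t : ℕ) :
    Fin L → Bool :=
  if h : 0 < t ∧ t ≤ 2 * n then τ ⟨t - 1, lt_of_lt_of_le (Nat.sub_lt h.1 one_pos) h.2⟩
  else fun _ => false

lemma ringMsg_succ {t : ℕ} (ht : t < 2 * n) (τ : (ringProtocol hn m r R c E).Transcript) :
    ringMsg hn E m r R c τ (t + 1) = τ ⟨t, ht⟩ :=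
  dif_pos ⟨t.succ_pos, ht⟩

lemma ringProtocol_send {t : ℕ} (ht : t < 2 * n) (τ : (ringProtocol hn m r R c E).Transcript) :
    (ringProtocol hn m r R c E).send ⟨t, ht⟩ y (z (role hn t))
      ((ringProtocol hn m r R c E).view (role hn t) t τ) =
      ringStep m r R c E t y (z (role hn t)) (ringMsg hn E m r R c τ t) := by
  change ringStep m r R c E t y (z (role hn t))
    (((ringProtocol hn m r R c E).view (role hn t) t τ ⟨t - 1, (by omega : t - 1 < 2 * n)⟩).getD
      fun _ => false) = _
  congr 1
  rcases t with _ | t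
  · rfl
  · have ht' : t < 2 * n := by omega
    have hv : (ringProtocol hn m r R c E).view (role hn (t + 1)) (t + 1) τ ⟨t, ht'⟩ =
        some (τ ⟨t, ht'⟩) := Protocol.view_eq_some _ t.lt_succ_self (Or.inr rfl)
    rw [ringMsg_succ hn E ht']
    change ((ringProtocol hn m r R c E).view (role hn (t + 1)) (t + 1) τ ⟨t, ht'⟩).getD _ = _
    rw [hv, Option.getD_some]

lemma ringMsg_mem {τ : (ringProtocol hn m r R c E).Transcript}
    (hτ : τ ∈ ((ringProtocol hn m r R c E).transcriptLaw y z (2 * n)).support) {t : ℕ}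
    (ht : t < 2 * n) :
    ringMsg hn E m r R c τ (t + 1) ∈
      (ringStep m r R c E t y (z (role hn t)) (ringMsg hn E m r R c τ t)).support := by
  rw [ringMsg_succ hn E ht, ← ringProtocol_send hn E z ht]
  exact (ringProtocol hn m r R c E).mem_support_send hτ ⟨t, ht⟩ ht

lemma expect_ringMsg {t : ℕ} (ht : t < 2 * n) (φ : (Fin L → Bool) → ℝ) :
    expect ((ringProtocol hn m r R c E).transcriptLaw y z (2 * n))
      (fun τ => φ (ringMsg hn E m r R c τ (t + 1))) =
    expect ((ringProtocol hn m r R c E).transcriptLaw y z (2 * n)) fun τ =>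
      expect (ringStep m r R c E t y (z (role hn t)) (ringMsg hn E m r R c τ t)) φ := by
  simp only [ringMsg_succ hn E ht, ← ringProtocol_send hn E z ht]
  refine ((ringProtocol hn m r R c E).expect_transcriptLaw_tower y z ⟨t, ht⟩
    (fun τ => φ (τ ⟨t, ht⟩)) (fun τ τ' h => by rw [h _ le_rfl])).trans ?_
  simp only [Function.update_self]
  rfl

/-- The reference of the ring protocol, in units of the grid. -/
def ringRef (c y : ℝ) : Fin d → ℤ := fun i => ⌊z (role hn 0) i / (c * y / d)⌋

/-- The normalized difference of the vector in role `t` and the reference. -/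
def ringDiff (c y : ℝ) (t : ℕ) : Fin d → ℝ := fun i =>
  (z (role hn t) i - c * y / d * ringRef hn z c y i) / (2 * (c * y))

/-- The sum of the contributions before step `t`, as read off from a transcript. -/
def ringSum (m r R : ℕ) (c y : ℝ) (τ : (ringProtocol hn m r R c E).Transcript) (t : ℕ) :
    Fin d → ℤ :=
  if t = 0 then 0 else
    (ringDecode E R (c * y / d) (2 * (c * y)) (z (role hn 0)) (ringMsg hn E m r R c τ t)).2

variable {E z}

lemma sum_abs_sub_ringRef_le (hd : 0 < d) (hcy : 0 < c * y)
    (hz : ∀ u v, ∑ i, |z u i - z v i| ≤ c * y) (v : Fin n) :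
    ∑ i, |z v i - c * y / d * ringRef hn z c y i| ≤ 2 * (c * y) := by
  have hd' : (0 : ℝ) < d := by exact_mod_cast hd
  set s := c * y / d with hs
  have hs0 : 0 < s := by positivity
  calc ∑ i, |z v i - s * ringRef hn z c y i|
      ≤ ∑ i, (|z v i - z (role hn 0) i| + s) := by
        refine Finset.sum_le_sum fun i _ => ?_
        have h1 := Int.floor_le (z (role hn 0) i / s)
        have h2 := Int.lt_floor_add_one (z (role hn 0) i / s)
        rw [le_div_iff₀ hs0] at h1
        rw [div_lt_iff₀ hs0] at h2
        have h3 : |z (role hn 0) i - s * ringRef hn z c y i| ≤ s := by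
          rw [abs_le, ringRef, ← hs]
          constructor <;> nlinarith
        have h4 := abs_add_le (z v i - z (role hn 0) i) (z (role hn 0) i - s * ringRef hn z c y i)
        rw [sub_add_sub_cancel] at h4
        linarith
    _ ≤ c * y + d * s := by
        rw [Finset.sum_add_distrib]
        have := hz v (role hn 0)
        simpa using this
    _ = 2 * (c * y) := by
        rw [hs]
        field_simp
        ring

lemma sum_abs_ringDiff_le (hd : 0 < d) (hcy : 0 < c * y)
    (hz : ∀ u v, ∑ i, |z u i - z v i| ≤ c * y) (t : ℕ) :
    ∑ i, |ringDiff hn z c y t i| ≤ 1 := by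
  have h := sum_abs_sub_ringRef_le hn hd hcy hz (role hn t)
  simp only [ringDiff, abs_div, abs_of_pos (by linarith : (0 : ℝ) < 2 * (c * y))]
  rw [← Finset.sum_div, div_le_one (by linarith)]
  exact h

variable (hd : 0 < d) (hcy : 0 < c * y) (hz : ∀ u v, ∑ i, |z u i - z v i| ≤ c * y)
  (hm : 0 < m) (hmn : m ≤ n) (hR : m * r ≤ R)
  (hE : ∀ s s', E s = E s' → ∑ i, |s.1 i - s'.1 i| ≤ 4 * d → ∑ i, |s.2 i| ≤ R →
      ∑ i, |s'.2 i| ≤ R → s = s')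
include hd hcy hz hE

lemma ringDecode_ringRef (v : Fin n) {K : Fin d → ℤ} (hK : ∑ i, |K i| ≤ R) :
    ringDecode E R (c * y / d) (2 * (c * y)) (z v) (E (ringRef hn z c y, K)) =
      (ringRef hn z c y, K) := by
  have hd' : (0 : ℝ) < d := by exact_mod_cast hd
  refine ringDecode_eq hE (by positivity) (le_of_eq ?_) (sum_abs_sub_ringRef_le hn hd hcy hz v) hK
  field_simp

/-- The law of the message of an adding role, if the previous message is as it should be. -/
lemma ringStep_eq {b : Fin L → Bool} {t : ℕ} (ht : t < m) {K : Fin d → ℤ}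
    (h0 : t = 0 → K = 0) (hb : 0 < t → b = E (ringRef hn z c y, K)) (hK : ∑ i, |K i| ≤ R) :
    ringStep m r R c E t y (z (role hn t)) b =
    (iidPMF (sparsePMF (ringDiff hn z c y t)) r).map fun f =>
      E (ringRef hn z c y, K + sparseSum (ringDiff hn z c y t) f) := by
  have key : (if t = 0 then (fun i => ⌊z (role hn t) i / (c * y / d)⌋, (0 : Fin d → ℤ)) else
      ringDecode E R (c * y / d) (2 * (c * y)) (z (role hn t)) b) = (ringRef hn z c y, K) := by
    by_cases ht0 : t = 0
    · rw [if_pos ht0, h0 ht0, ht0]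
      rfl
    · rw [if_neg ht0, hb (Nat.pos_of_ne_zero ht0), ringDecode_ringRef hn hd hcy hz hE _ hK]
  rw [ringStep]
  simp only [key, if_pos ht]
  rfl

include hmn hR

/-- Up to step `m` the messages encode the reference and the sum of the contributions. -/
lemma ringProtocol_message {τ : (ringProtocol hn m r R c E).Transcript}
    (hτ : τ ∈ ((ringProtocol hn m r R c E).transcriptLaw y z (2 * n)).support) {t : ℕ}
    (ht : t ≤ m) :
    (0 < t → ringMsg hn E m r R c τ t = E (ringRef hn z c y, ringSum hn E z m r R c y τ t)) ∧
    ∑ i, |ringSum hn E z m r R c y τ t i| ≤ t * r := by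
  induction t with
  | zero => simp [ringSum]
  | succ t ih =>
    obtain ⟨ih1, ih2⟩ := ih (by omega)
    have hmem := ringMsg_mem hn E z hτ (t := t) (by omega)
    rw [ringStep_eq hn hd hcy hz hE (K := ringSum hn E z m r R c y τ t) (by omega)
      (fun h => by rw [ringSum, if_pos h]) ih1
      (ih2.trans (by exact_mod_cast (Nat.mul_le_mul_right r (by omega)).trans hR)),
      PMF.mem_support_map_iff] at hmem
    obtain ⟨f, -, hf⟩ := hmem
    have hbound := sum_abs_add_sparseSum_le ih2 (sum_abs_sparseSum_le (ringDiff hn z c y t) f)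
    have hsum : ringSum hn E z m r R c y τ (t + 1) =
        ringSum hn E z m r R c y τ t + sparseSum (ringDiff hn z c y t) f := by
      conv_lhs => rw [ringSum, if_neg t.succ_ne_zero]
      rw [← hf, ringDecode_ringRef hn hd hcy hz hE _
        (hbound.trans (by exact_mod_cast (Nat.mul_le_mul_right r ht).trans hR))]
    rw [hsum]
    exact ⟨fun _ => hf.symm, hbound⟩

/-- The effect of one step on the sum of the contributions. -/
lemma expect_ringSum_succ {t : ℕ} (ht : t < m) (i : Fin d) (φ : ℝ → ℝ) :
    expect ((ringProtocol hn m r R c E).transcriptLaw y z (2 * n))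
      (fun τ => φ (ringSum hn E z m r R c y τ (t + 1) i)) =
    expect ((ringProtocol hn m r R c E).transcriptLaw y z (2 * n)) fun τ =>
      expect (iidPMF (sparsePMF (ringDiff hn z c y t)) r) fun f =>
        φ (ringSum hn E z m r R c y τ t i + sparseSum (ringDiff hn z c y t) f i) := by
  refine Eq.trans ?_ ((expect_ringMsg hn E z (t := t) (by omega) fun b =>
    φ ((ringDecode E R (c * y / d) (2 * (c * y)) (z (role hn 0)) b).2 i)).trans
      (expect_congr fun τ hτ => ?_))
  · simp only [ringSum, if_neg t.succ_ne_zero]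
  · obtain ⟨h1, h2⟩ := ringProtocol_message hn hd hcy hz hmn hR hE hτ ht.le
    rw [ringStep_eq hn hd hcy hz hE (K := ringSum hn E z m r R c y τ t) (by omega)
      (fun h => by rw [ringSum, if_pos h]) h1
      (h2.trans (by exact_mod_cast (Nat.mul_le_mul_right r ht.le).trans hR)), expect_map]
    congr 1
    funext f
    have hbound := sum_abs_add_sparseSum_le h2 (sum_abs_sparseSum_le (ringDiff hn z c y t) f)
    rw [ringDecode_ringRef hn hd hcy hz hE _
      (hbound.trans (by exact_mod_cast (Nat.mul_le_mul_right r ht).trans hR))]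
    simp

lemma expect_ringSum {t : ℕ} (ht : t ≤ m) (i : Fin d) :
    expect ((ringProtocol hn m r R c E).transcriptLaw y z (2 * n))
      (fun τ => (ringSum hn E z m r R c y τ t i : ℝ)) =
    ∑ u ∈ Finset.range t, r * ringDiff hn z c y u i := by
  induction t with
  | zero => simp [ringSum, expect_const]
  | succ t ih =>
    rw [expect_ringSum_succ hn hd hcy hz hmn hR hE ht i (fun x => x), Finset.sum_range_succ,
      ← ih (by omega)]
    simp only [expect_add, expect_const,
      expect_sparseSum (sum_abs_ringDiff_le hn hd hcy hz t) r i]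

lemma expect_ringSum_sub_sq_le {t : ℕ} (ht : t ≤ m) (i : Fin d) :
    expect ((ringProtocol hn m r R c E).transcriptLaw y z (2 * n))
      (fun τ => ((ringSum hn E z m r R c y τ t i : ℝ) -
        ∑ u ∈ Finset.range t, r * ringDiff hn z c y u i) ^ 2) ≤
    ∑ u ∈ Finset.range t, r * |ringDiff hn z c y u i| := by
  induction t with
  | zero => simp [ringSum, expect_const]
  | succ t ih =>
    rw [expect_ringSum_succ hn hd hcy hz hmn hR hE ht i (fun x =>
      (x - ∑ u ∈ Finset.range (t + 1), r * ringDiff hn z c y u i) ^ 2)]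
    refine le_trans (b := expect ((ringProtocol hn m r R c E).transcriptLaw y z (2 * n))
      fun τ => ((ringSum hn E z m r R c y τ t i : ℝ) -
        ∑ u ∈ Finset.range t, r * ringDiff hn z c y u i) ^ 2 + r * |ringDiff hn z c y t i|)
      (expect_mono fun τ _ => ?_) ?_
    · set X := (ringSum hn E z m r R c y τ t i : ℝ) -
        ∑ u ∈ Finset.range t, r * ringDiff hn z c y u i with hX
      have hf : ∀ f : Fin r → Option (Fin d),
          ((ringSum hn E z m r R c y τ t i : ℝ) + sparseSum (ringDiff hn z c y t) f i -
            ∑ u ∈ Finset.range (t + 1), r * ringDiff hn z c y u i) ^ 2 =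
          X ^ 2 + 2 * X * (sparseSum (ringDiff hn z c y t) f i - r * ringDiff hn z c y t i) +
            (sparseSum (ringDiff hn z c y t) f i - r * ringDiff hn z c y t i) ^ 2 := by
        intro f
        rw [Finset.sum_range_succ, hX]
        ring
      have hw := sum_abs_ringDiff_le hn hd hcy hz t
      simp only [hf, expect_add, expect_const, expect_const_mul, expect_sub,
        expect_sparseSum hw r i, sub_self, mul_zero, add_zero]
      exact add_le_add le_rfl (expect_sparseSum_sub_sq_le hw r i)
    · rw [expect_add, expect_const, Finset.sum_range_succ]
      exact add_le_add (ih (by omega)) le_rfl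

include hm

lemma ringProtocol_copy {τ : (ringProtocol hn m r R c E).Transcript}
    (hτ : τ ∈ ((ringProtocol hn m r R c E).transcriptLaw y z (2 * n)).support) {t : ℕ}
    (ht : m ≤ t) (ht2 : t ≤ 2 * n) :
    ringMsg hn E m r R c τ t = E (ringRef hn z c y, ringSum hn E z m r R c y τ m) := by
  induction t, ht using Nat.le_induction with
  | base => exact (ringProtocol_message hn hd hcy hz hmn hR hE hτ le_rfl).1 hm
  | succ t ht ih =>
    have hmem := ringMsg_mem hn E z hτ (t := t) (by omega)
    rw [ringStep, if_neg (by omega), PMF.mem_support_pure_iff] at hmem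
    rw [hmem, ih (by omega)]

/-- Correctness of the ring protocol, with the variance measured by the sum of squares. -/
lemma ringProtocol_correct (hy : 0 < y) (hr : 0 < r) :
    ∃ est : (ringProtocol hn m r R c E).Transcript → Fin d → ℝ,
      (∀ τ ∈ ((ringProtocol hn m r R c E).transcriptLaw y z (2 * n)).support, ∀ v,
        (ringProtocol hn m r R c E).output v y (z v)
          ((ringProtocol hn m r R c E).view v (2 * n) τ) = est τ) ∧
      (∀ i, expect ((ringProtocol hn m r R c E).transcriptLaw y z (2 * n)) (fun τ => est τ i) =
        sampleMean m z i) ∧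
      expect ((ringProtocol hn m r R c E).transcriptLaw y z (2 * n)) (fun τ =>
        ∑ i, (est τ i - sampleMean m z i) ^ 2) ≤ (2 * (c * y)) ^ 2 / (m * r) := by
  have hm' : (0 : ℝ) < m := by exact_mod_cast hm
  have hr' : (0 : ℝ) < r := by exact_mod_cast hr
  set W := 2 * (c * y) with hW
  set s := c * y / d with hs
  have hW0 : 0 < W := by positivity
  have hmean : ∀ i, sampleMean m z i = s * ringRef hn z c y i +
      W / (m * r) * ∑ u ∈ Finset.range m, r * ringDiff hn z c y u i := by
    intro i
    simp only [sampleMean, ringDiff, ← hW, ← hs]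
    rw [sum_filter_val_lt hn hmn fun v => z v i, ← Finset.mul_sum, ← Finset.sum_div,
      Finset.sum_sub_distrib, Finset.sum_const, Finset.card_range, nsmul_eq_mul]
    field_simp
    ring
  refine ⟨fun τ i => s * ringRef hn z c y i + W / (m * r) * ringSum hn E z m r R c y τ m i,
    fun τ hτ v => ?_, fun i => ?_, ?_⟩
  · have hlt : n + (v : ℕ) < 2 * n := by omega
    have hcopy := ringProtocol_copy hn hd hcy hz hm hmn hR hE hτ (t := n + v + 1) (by omega) hlt
    rw [ringMsg_succ hn E hlt] at hcopy
    have hview : (ringProtocol hn m r R c E).view v (2 * n) τ ⟨n + v, hlt⟩ =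
        some (τ ⟨n + v, hlt⟩) :=
      Protocol.view_eq_some _ hlt (Or.inl (role_add_self hn v))
    rw [hcopy] at hview
    have hbd := (ringProtocol_message hn hd hcy hz hmn hR hE hτ le_rfl).2
    have hdec := ringDecode_ringRef hn hd hcy hz hE v
      (K := ringSum hn E z m r R c y τ m) (hbd.trans (by exact_mod_cast hR))
    funext i
    change (if y ≤ 0 then z v i else
      c * y / d * (ringDecode E R (c * y / d) (2 * (c * y)) (z v)
        (((ringProtocol hn m r R c E).view v (2 * n) τ ⟨n + v, hlt⟩).getD fun _ => false)).1 i +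
      2 * (c * y) / (m * r) * (ringDecode E R (c * y / d) (2 * (c * y)) (z v)
        (((ringProtocol hn m r R c E).view v (2 * n) τ ⟨n + v, hlt⟩).getD fun _ => false)).2 i) = _
    rw [if_neg (not_le.2 hy), hview]
    change c * y / d * (ringDecode E R (c * y / d) (2 * (c * y)) (z v)
        (E (ringRef hn z c y, ringSum hn E z m r R c y τ m))).1 i +
      2 * (c * y) / (m * r) * (ringDecode E R (c * y / d) (2 * (c * y)) (z v)
        (E (ringRef hn z c y, ringSum hn E z m r R c y τ m))).2 i = _
    rw [hdec]
  · rw [expect_add, expect_const, expect_const_mul, expect_ringSum hn hd hcy hz hmn hR hE le_rfl,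
      hmean]
  · have hsq : ∀ (τ : (ringProtocol hn m r R c E).Transcript) i,
        (s * ringRef hn z c y i + W / (m * r) * ringSum hn E z m r R c y τ m i -
          sampleMean m z i) ^ 2 = (W / (m * r)) ^ 2 * ((ringSum hn E z m r R c y τ m i : ℝ) -
            ∑ u ∈ Finset.range m, r * ringDiff hn z c y u i) ^ 2 := by
      intro τ i
      rw [hmean]
      ring
    simp only [hsq]
    rw [expect_sum]
    simp only [expect_const_mul]
    calc _ ≤ ∑ i, (W / (m * r)) ^ 2 * ∑ u ∈ Finset.range m, r * |ringDiff hn z c y u i| :=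
          Finset.sum_le_sum fun i _ => mul_le_mul_of_nonneg_left
            (expect_ringSum_sub_sq_le hn hd hcy hz hmn hR hE le_rfl i) (by positivity)
      _ = (W / (m * r)) ^ 2 * ∑ u ∈ Finset.range m, r * ∑ i, |ringDiff hn z c y u i| := by
          rw [← Finset.mul_sum, Finset.sum_comm]
          simp only [Finset.mul_sum]
      _ ≤ (W / (m * r)) ^ 2 * ∑ _u ∈ Finset.range m, (r : ℝ) * 1 := by
          gcongr
          exact sum_abs_ringDiff_le hn hd hcy hz _
      _ = W ^ 2 / (m * r) := by
          simp only [Finset.sum_const, Finset.card_range, nsmul_eq_mul]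
          field_simp

end Analysis

end Ring

/-! ### The protocol for the `ℓ_∞` norm -/

section Scatter

variable {ℓ : ℕ}

/-- The group of the role `v`: the roles below `m` are divided into `m / B` groups, with `B` roles
in all of them but the last, which also gets the remaining ones. -/
def group (m B v : ℕ) : ℕ := min (v / B) (m / B - 1)

/-- The number of roles in the groups before group `γ`, in units of `B`. -/
def groupWeight (m B γ : ℕ) : ℝ :=
  (B : ℝ)⁻¹ * ((Finset.range m).filter fun v => group m B v < γ).card

/-- The integer with code `b` at distance at most `D` from `c`. It is unique if `2 * D < 2 ^ ℓ` and
the code is injective on integers at distance less than `2 ^ ℓ`; if there is none, the value is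
arbitrary. -/
def intDecode (E : ℤ → (Fin ℓ → Bool)) (D c : ℝ) (b : Fin ℓ → Bool) : ℤ :=
  Classical.epsilon fun a => E a = b ∧ |a - c| ≤ D

lemma intDecode_eq {E : ℤ → (Fin ℓ → Bool)} {D : ℝ}
    (hE : ∀ a b, E a = E b → |a - b| < 2 ^ ℓ → a = b) (hD : 2 * D < 2 ^ ℓ) {c : ℝ} {a : ℤ}
    (ha : |a - c| ≤ D) : intDecode E D c (E a) = a := by
  obtain ⟨h1, h2⟩ := Classical.epsilon_spec (p := fun a' : ℤ => E a' = E a ∧ |a' - c| ≤ D)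
    ⟨a, rfl, ha⟩
  refine hE _ _ h1 ?_
  have h3 : |((intDecode E D c (E a) : ℤ) : ℝ) - a| < 2 ^ ℓ := by
    refine lt_of_le_of_lt (abs_sub_le _ c _) ?_
    rw [abs_sub_comm c]
    exact lt_of_le_of_lt (add_le_add h2 ha) (by linarith)
  exact_mod_cast h3

/-- The law of message number `s` for one coordinate in the scatter protocol. The sender has the
value `x` in this coordinate, in units of the grid, and `prev` are the earlier messages for the
coordinate. -/
def scatterStep (m B : ℕ) (D : ℝ) (E : ℤ → (Fin ℓ → Bool)) (s : ℕ) (x : ℝ)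
    (prev : ℕ → (Fin ℓ → Bool)) : PMF (Fin ℓ → Bool) :=
  if s < m then randomRound x E
  else if s < m + m / B then
    randomRound ((if s = m then 0 else
        (intDecode E D (groupWeight m B (s - m) * x) (prev (s - 1)) : ℝ)) +
      (B : ℝ)⁻¹ * ∑ v ∈ (Finset.range m).filter (fun v => group m B v = s - m),
        (intDecode E D x (prev v) : ℝ)) E
  else PMF.pure (prev (s - 1))

/-- The sender of message number `s` for coordinate `i`. -/
def scatterSender {n : ℕ} (hn : 0 < n) (m B i s : ℕ) : Fin n :=
  if s < m then role hn s
  else if s < m + m / B then role hn ((s - m) * B + i % B)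
  else role hn (s - (m + m / B))

/-- The receiver of message number `s` for coordinate `i`. -/
def scatterReceiver {n : ℕ} (hn : 0 < n) (m B i s : ℕ) : Fin n :=
  if s < m then role hn (group m B s * B + i % B)
  else if s + 1 < m + m / B then role hn ((s + 1 - m) * B + i % B)
  else role hn (s + 1 - (m + m / B))

/-- The protocol treats each coordinate `i` separately, with values rounded to integer multiples of
a grid of width `y / Q`, which are sent modulo `2 ^ ℓ` only: the receiver knows them up to an error
`D < 2 ^ ℓ / 2` from its own value. The roles below `m` are divided into groups of about `B`. In
each group there is a collector for coordinate `i`, namely the member number `i % B`. All members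
send their values to it; then the collectors of all groups form a chain and add up the totals of
their groups, divided by `B` and rounded to integers; finally the sum is passed around all roles,
role `v` sending it in step `m + m / B + v`. As different coordinates have different collectors,
the load is balanced. For `y = 0` there is no grid, but then all vectors are equal. -/
def scatterProtocol {n : ℕ} (hn : 0 < n) (d m B Q : ℕ) (D : ℝ) (E : ℤ → (Fin ℓ → Bool)) :
    Protocol n d where
  steps := d * (m + (m / B + n))
  sender k := scatterSender hn m B (finProdFinEquiv.symm k).1 (finProdFinEquiv.symm k).2
  receiver k := scatterReceiver hn m B (finProdFinEquiv.symm k).1 (finProdFinEquiv.symm k).2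
  len _ := ℓ
  send k y x v := scatterStep m B D E (finProdFinEquiv.symm k).2
    (x (finProdFinEquiv.symm k).1 / (y / Q)) fun s =>
      if h : s < m + (m / B + n) then
        (v (finProdFinEquiv ((finProdFinEquiv.symm k).1, ⟨s, h⟩))).getD fun _ => false
      else fun _ => false
  output r y x v := fun i => if y ≤ 0 then x i else
    y / Q * (B / m) * intDecode E D (groupWeight m B (m / B) * (x i / (y / Q)))
      ((v (finProdFinEquiv (i, ⟨m + (m / B + r), by omega⟩))).getD fun _ => false)

section Load

variable {n : ℕ} (hn : 0 < n)

lemma sum_ite_le_of_subset {s t : Finset ℕ} {p : ℕ → Prop} [DecidablePred p] {c : ℕ}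
    (h : ∀ k ∈ s, p k → k ∈ t) (ht : t.card ≤ c) (l : ℕ) :
    ∑ k ∈ s, (if p k then l else 0) ≤ c * l := by
  rw [← Finset.sum_filter, Finset.sum_const, smul_eq_mul]
  refine Nat.mul_le_mul_right _ ((Finset.card_le_card fun k hk => ?_).trans ht)
  rw [Finset.mem_filter] at hk
  exact h k hk.1 hk.2

lemma eq_of_role_eq {k : ℕ} {r : Fin n} (hk : k < n) (h : role hn k = r) : k = r := by
  rw [← h]
  exact (Nat.mod_eq_of_lt hk).symm

lemma eq_div_of_mul_add_mod_eq {B g i r : ℕ} (hB : 0 < B) (h : g * B + i % B = r) :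
    g = r / B := by
  rw [← h, mul_comm, Nat.mul_add_div hB, Nat.div_eq_of_lt (Nat.mod_lt _ hB), add_zero]

lemma collector_lt {m B g i : ℕ} (hB : 0 < B) (hmn : m ≤ n) (hg : g < m / B) :
    g * B + i % B < n := by
  have h1 := Nat.mod_lt i hB
  have h2 : (g + 1) * B ≤ m / B * B := Nat.mul_le_mul_right _ hg
  have h3 := Nat.div_mul_le_self m B
  rw [Nat.add_mul] at h2
  omega

lemma sum_scatterSender_le {m B : ℕ} (hB : 0 < B) (hmn : m ≤ n) (i : ℕ) (r : Fin n) (l : ℕ) :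
    ∑ s ∈ Finset.range (m + (m / B + n)), (if scatterSender hn m B i s = r then l else 0) ≤
      3 * l := by
  rw [Finset.sum_range_add, Finset.sum_range_add]
  have h1 : ∑ s ∈ Finset.range m, (if scatterSender hn m B i s = r then l else 0) ≤ 1 * l := by
    refine sum_ite_le_of_subset (t := {(r : ℕ)}) (fun s hs h => ?_) (by simp) l
    rw [Finset.mem_range] at hs
    rw [scatterSender, if_pos hs] at h
    rw [Finset.mem_singleton]
    exact eq_of_role_eq hn (by omega) h
  have h2 : ∑ s ∈ Finset.range (m / B), (if scatterSender hn m B i (m + s) = r then l else 0) ≤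
      1 * l := by
    refine sum_ite_le_of_subset (t := {(r : ℕ) / B}) (fun s hs h => ?_) (by simp) l
    rw [Finset.mem_range] at hs
    rw [scatterSender, if_neg (by omega), if_pos (by omega), Nat.add_sub_cancel_left] at h
    rw [Finset.mem_singleton]
    exact eq_div_of_mul_add_mod_eq hB (eq_of_role_eq hn (collector_lt hB hmn hs) h)
  have h3 : ∑ s ∈ Finset.range n,
      (if scatterSender hn m B i (m + (m / B + s)) = r then l else 0) ≤ 1 * l := by
    refine sum_ite_le_of_subset (t := {(r : ℕ)}) (fun s hs h => ?_) (by simp) l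
    rw [Finset.mem_range] at hs
    rw [scatterSender, if_neg (by have := Nat.zero_le (m / B); omega), if_neg (by omega),
      ← add_assoc, Nat.add_sub_cancel_left] at h
    rw [Finset.mem_singleton]
    exact eq_of_role_eq hn hs h
  omega

lemma sum_scatterReceiver_le {m B : ℕ} (hB : 0 < B) (hmn : m ≤ n) (i : ℕ) (r : Fin n) (l : ℕ) :
    ∑ s ∈ Finset.range (m + (m / B + n)), (if scatterReceiver hn m B i s = r then l else 0) ≤
      ∑ s ∈ Finset.range m, (if scatterReceiver hn m B i s = r then l else 0) + 4 * l := by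
  rw [Finset.sum_range_add, Finset.sum_range_add]
  have h2 : ∑ s ∈ Finset.range (m / B), (if scatterReceiver hn m B i (m + s) = r then l else 0) ≤
      2 * l := by
    refine sum_ite_le_of_subset (t := {m / B - 1, (r : ℕ) / B - 1}) (fun s hs h => ?_)
      Finset.card_le_two l
    rw [Finset.mem_range] at hs
    rw [Finset.mem_insert, Finset.mem_singleton]
    by_cases hs1 : s + 1 < m / B
    · rw [scatterReceiver, if_neg (by omega), if_pos (by omega), add_assoc,
        Nat.add_sub_cancel_left] at h
      have := eq_div_of_mul_add_mod_eq hB (eq_of_role_eq hn (collector_lt hB hmn hs1) h)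
      omega
    · omega
  have h3 : ∑ s ∈ Finset.range n,
      (if scatterReceiver hn m B i (m + (m / B + s)) = r then l else 0) ≤ 2 * l := by
    refine sum_ite_le_of_subset (t := {n - 1, (r : ℕ) - 1}) (fun s hs h => ?_)
      Finset.card_le_two l
    rw [Finset.mem_range] at hs
    rw [Finset.mem_insert, Finset.mem_singleton]
    by_cases hs1 : s + 1 < n
    · rw [scatterReceiver, if_neg (by have := Nat.zero_le (m / B); omega), if_neg (by omega),
        show m + (m / B + s) + 1 - (m + m / B) = s + 1 by omega] at h
      have := eq_of_role_eq hn hs1 h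
      omega
    · omega
  omega

/-- A collector serves about `d / B` coordinates and about `B` roles. -/
lemma sum_scatterReceiver_collect_le {d m B : ℕ} (hB : 0 < B) (hmn : m ≤ n) (hBm : B ≤ m)
    (hBd : B ≤ d) (r : Fin n) (l : ℕ) :
    ∑ i ∈ Finset.range d, ∑ s ∈ Finset.range m,
      (if scatterReceiver hn m B i s = r then l else 0) ≤ 4 * d * l := by
  have hG : 0 < m / B := Nat.div_pos hBm hB
  have h1 : ∀ i, ∑ s ∈ Finset.range m, (if scatterReceiver hn m B i s = r then l else 0) ≤
      if i % B = r % B then 2 * B * l else 0 := by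
    intro i
    have key : ∀ s ∈ Finset.range m, scatterReceiver hn m B i s = r →
        group m B s * B + i % B = r := by
      intro s hs h
      rw [Finset.mem_range] at hs
      rw [scatterReceiver, if_pos hs] at h
      refine eq_of_role_eq hn (collector_lt hB hmn ?_) h
      rw [group]
      omega
    split_ifs with hi
    · refine sum_ite_le_of_subset (t := Finset.Ico (r / B * B) (r / B * B + 2 * B))
        (fun s hs h => ?_) (by simp) l
      have hg := eq_div_of_mul_add_mod_eq hB (key s hs h)
      rw [← hg, Finset.mem_Ico]
      rw [Finset.mem_range] at hs
      have h2 := Nat.div_mul_le_self s B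
      have h3 := Nat.lt_div_mul_add (a := s) hB
      have h4 := Nat.lt_div_mul_add (a := m) hB
      refine ⟨(Nat.mul_le_mul_right B (min_le_left _ _)).trans h2, ?_⟩
      rcases le_total (s / B) (m / B - 1) with hc | hc
      · rw [group, min_eq_left hc]
        omega
      · rw [group, min_eq_right hc, Nat.sub_mul]
        have : 1 * B ≤ m / B * B := Nat.mul_le_mul_right _ hG
        omega
    · rw [Finset.sum_eq_zero]
      intro s hs
      rw [if_neg]
      intro h
      apply hi
      rw [← key s hs h, mul_comm, Nat.mul_add_mod, Nat.mod_mod]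
  calc _ ≤ ∑ i ∈ Finset.range d, (if i % B = r % B then 2 * B * l else 0) :=
        Finset.sum_le_sum fun i _ => h1 i
    _ ≤ (d / B + 1) * (2 * B * l) := by
        rw [← Finset.sum_filter, Finset.sum_const, smul_eq_mul]
        exact Nat.mul_le_mul_right _ (card_filter_add_mod_le d B 0 (r % B))
    _ ≤ 4 * d * l := by
        have h2 := Nat.div_mul_le_self d B
        have h3 : (d / B + 1) * (2 * B) ≤ 4 * d := by nlinarith
        rw [← mul_assoc]
        exact Nat.mul_le_mul_right _ h3

lemma sum_steps_eq (d S : ℕ) (f : ℕ → ℕ → ℕ) :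
    ∑ k : Fin (d * S), f (finProdFinEquiv.symm k).1 (finProdFinEquiv.symm k).2 =
      ∑ i ∈ Finset.range d, ∑ s ∈ Finset.range S, f i s := by
  rw [Equiv.sum_comp finProdFinEquiv.symm fun p : Fin d × Fin S => f p.1 p.2,
    Fintype.sum_prod_type, ← Fin.sum_univ_eq_sum_range fun i => ∑ s ∈ Finset.range S, f i s]
  exact Finset.sum_congr rfl fun i _ => Fin.sum_univ_eq_sum_range (f i) S

lemma scatterProtocol_bits_le {d m B Q : ℕ} {D : ℝ} {E : ℤ → (Fin ℓ → Bool)} (hB : 0 < B)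
    (hmn : m ≤ n) (hBm : B ≤ m) (hBd : B ≤ d) (r : Fin n) :
    (scatterProtocol hn d m B Q D E).bits r ≤ 11 * d * ℓ := by
  have h1 := sum_steps_eq d (m + (m / B + n)) fun i s =>
    if scatterSender hn m B i s = r then ℓ else 0
  have h2 := sum_steps_eq d (m + (m / B + n)) fun i s =>
    if scatterReceiver hn m B i s = r then ℓ else 0
  refine (add_le_add h1.le h2.le).trans ?_
  have h3 := Finset.sum_le_sum fun i (_ : i ∈ Finset.range d) =>
    sum_scatterSender_le hn hB hmn i r ℓ
  have h4 := Finset.sum_le_sum fun i (_ : i ∈ Finset.range d) =>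
    sum_scatterReceiver_le hn hB hmn i r ℓ
  have h5 := sum_scatterReceiver_collect_le hn hB hmn hBm hBd r ℓ
  rw [Finset.sum_const, Finset.card_range, smul_eq_mul] at h3
  rw [Finset.sum_add_distrib, Finset.sum_const, Finset.card_range, smul_eq_mul] at h4
  nlinarith

end Load

end Scatter

section ScatterAnalysis

variable {ℓ : ℕ}

/-! ### The messages for one coordinate -/

section Coordinate

variable (m B : ℕ) (D : ℝ) (E : ℤ → (Fin ℓ → Bool)) (c₀ : ℝ) (msg : ℕ → (Fin ℓ → Bool))

/-- The value of role `v`, rounded to an integer, as read off from the messages. -/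
def collected (v : ℕ) : ℤ := intDecode E D c₀ (msg v)

/-- The sum over the groups before `γ` that the collectors pass on, as read off from the
messages. -/
def chainSum (γ : ℕ) : ℤ :=
  if γ = 0 then 0 else intDecode E D (groupWeight m B γ * c₀) (msg (m + γ - 1))

/-- The exact sum of the rounded values over the groups before `γ`, divided by `B`. -/
def exactSum (f : ℕ → ℝ) (γ : ℕ) : ℝ :=
  (B : ℝ)⁻¹ * ∑ v ∈ (Finset.range m).filter (fun v => group m B v < γ), f v

variable {m B D E c₀ msg}

lemma exactSum_succ (f : ℕ → ℝ) (γ : ℕ) : exactSum m B f (γ + 1) = exactSum m B f γ +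
    (B : ℝ)⁻¹ * ∑ v ∈ (Finset.range m).filter (fun v => group m B v = γ), f v := by
  rw [exactSum, exactSum, ← mul_add]
  congr 1
  rw [← Finset.sum_union]
  · refine Finset.sum_congr ?_ fun _ _ => rfl
    ext v
    simp only [Finset.mem_filter, Finset.mem_union, Finset.mem_range]
    omega
  · rw [Finset.disjoint_filter]
    intro v _ h1 h2
    omega

lemma filter_group_lt (hB : 0 < B) (hBm : B ≤ m) :
    (Finset.range m).filter (fun v => group m B v < m / B) = Finset.range m := by
  refine Finset.filter_true_of_mem fun v _ => ?_
  have := Nat.div_pos hBm hB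
  rw [group]
  omega

variable {n Q : ℕ} (hn : 0 < n) {c : Fin n → ℝ} {i : ℕ}
  (hB : 0 < B) (hmQ : m ≤ B * Q) (hD : D = Q * (Q + 2)) (hD2 : 2 * D < 2 ^ ℓ)
  (hE : ∀ a b, E a = E b → |a - b| < 2 ^ ℓ → a = b)
  (hc : ∀ u v, |c u - c v| ≤ Q)

include hB hmQ in
lemma groupWeight_le (γ : ℕ) : groupWeight m B γ ≤ Q := by
  have hB' : (0 : ℝ) < B := by exact_mod_cast hB
  rw [groupWeight, inv_mul_le_iff₀ hB']
  have h := Finset.card_filter_le (Finset.range m) fun v => group m B v < γ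
  rw [Finset.card_range] at h
  exact_mod_cast h.trans hmQ

include hmQ in
lemma exactSum_sub_le (hB : 0 < B) {f : ℕ → ℝ} {x : ℝ} {δ : ℝ} (hδ : 0 ≤ δ)
    (hf : ∀ v < m, |f v - x| ≤ δ) (γ : ℕ) :
    |exactSum m B f γ - groupWeight m B γ * x| ≤ Q * δ := by
  have hB' : (0 : ℝ) < B := by exact_mod_cast hB
  have h : exactSum m B f γ - groupWeight m B γ * x =
      (B : ℝ)⁻¹ * ∑ v ∈ (Finset.range m).filter (fun v => group m B v < γ), (f v - x) := by
    rw [Finset.sum_sub_distrib, Finset.sum_const, nsmul_eq_mul, exactSum, groupWeight]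
    ring
  rw [h, abs_mul, abs_of_pos (by positivity)]
  calc _ ≤ (B : ℝ)⁻¹ * ∑ _v ∈ (Finset.range m).filter (fun v => group m B v < γ), δ := by
        refine mul_le_mul_of_nonneg_left ((Finset.abs_sum_le_sum_abs _ _).trans
          (Finset.sum_le_sum fun v hv => hf v ?_)) (by positivity)
        exact Finset.mem_range.1 (Finset.mem_filter.1 hv).1
    _ = groupWeight m B γ * δ := by
        rw [Finset.sum_const, nsmul_eq_mul, groupWeight]
        ring
    _ ≤ Q * δ := mul_le_mul_of_nonneg_right (groupWeight_le hB hmQ γ) hδ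

variable (hQ : 0 < Q)
  (hmem : ∀ s < m + (m / B + n),
    msg s ∈ (scatterStep m B D E s (c (scatterSender hn m B i s)) msg).support)
include hD hD2 hE hc hQ

lemma intDecode_of_abs_sub_le_one {a : ℤ} {u : Fin n} (ha : |a - c u| ≤ 1) (w : Fin n) :
    intDecode E D (c w) (E a) = a := by
  refine intDecode_eq hE hD2 ?_
  have hQ' : (1 : ℝ) ≤ Q := by exact_mod_cast hQ
  have h1 := abs_sub_le (a : ℝ) (c u) (c w)
  have h2 := hc u w
  rw [hD]
  nlinarith

include hmem

/-- The roles agree on the values that have been sent to the collectors. -/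
lemma collected_spec {v : ℕ} (hv : v < m) (w w₀ : Fin n) :
    |(collected D E (c w₀) msg v : ℝ) - c (role hn v)| ≤ 1 ∧
      intDecode E D (c w) (msg v) = collected D E (c w₀) msg v := by
  have h := hmem v (Nat.lt_add_right _ hv)
  rw [scatterStep, if_pos hv, scatterSender, if_pos hv] at h
  obtain ⟨a, ha1, ha2⟩ := exists_of_mem_support_randomRound h
  have key := intDecode_of_abs_sub_le_one hD hD2 hE hc hQ ha2
  rw [collected, ha1, key, key]
  exact ⟨ha2, rfl⟩

include hB hmQ

lemma intDecode_of_abs_sub_exactSum_le {w₀ : Fin n} {a : ℤ} {γ : ℕ} (hγ : γ ≤ m / B)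
    (ha : |a - exactSum m B (fun v => (collected D E (c w₀) msg v : ℝ)) γ| ≤ γ) (w : Fin n) :
    intDecode E D (groupWeight m B γ * c w) (E a) = a := by
  refine intDecode_eq hE hD2 ?_
  have h1 := exactSum_sub_le hmQ hB (f := fun v => (collected D E (c w₀) msg v : ℝ)) (x := c w)
    (δ := Q + 1) (by positivity) (fun v hv => by
      have h1 := (collected_spec hn hD hD2 hE hc hQ hmem hv w w₀).1
      have h2 := hc (role hn v) w
      have h3 := abs_sub_le (collected D E (c w₀) msg v : ℝ) (c (role hn v)) (c w)
      linarith) γ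
  have h2 : γ ≤ Q := hγ.trans (Nat.div_le_of_le_mul hmQ)
  have h2' : (γ : ℝ) ≤ Q := by exact_mod_cast h2
  have h3 := abs_sub_le (a : ℝ) (exactSum m B (fun v => (collected D E (c w₀) msg v : ℝ)) γ)
    (groupWeight m B γ * c w)
  rw [hD]
  nlinarith

/-- The message of the collector of group `γ`, if the previous one is as it should be. -/
lemma scatterStep_chain {γ : ℕ} (hγ : γ < m / B) (w w₀ : Fin n)
    (h : 0 < γ → msg (m + γ - 1) = E (chainSum m B D E (c w₀) msg γ))
    (h2 : |(chainSum m B D E (c w₀) msg γ : ℝ) -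
      exactSum m B (fun v => (collected D E (c w₀) msg v : ℝ)) γ| ≤ γ) :
    scatterStep m B D E (m + γ) (c w) msg = randomRound (chainSum m B D E (c w₀) msg γ +
      (B : ℝ)⁻¹ * ∑ v ∈ (Finset.range m).filter (fun v => group m B v = γ),
        (collected D E (c w₀) msg v : ℝ)) E := by
  rw [scatterStep, if_neg (by omega), if_pos (by omega), Nat.add_sub_cancel_left]
  congr 2
  · by_cases h0 : γ = 0
    · simp [h0, chainSum]
    · rw [if_neg (by omega), h (by omega), intDecode_of_abs_sub_exactSum_le hn hB hmQ hD hD2 hE hc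
        hQ hmem hγ.le h2]
  · congr 1
    refine Finset.sum_congr rfl fun v hv => ?_
    rw [(collected_spec hn hD hD2 hE hc hQ hmem
      (Finset.mem_range.1 (Finset.mem_filter.1 hv).1) w w₀).2]

/-- The sums of the chain of collectors are transmitted correctly, and each collector adds a
rounding error of at most one. -/
lemma chainSum_spec (w₀ : Fin n) {γ : ℕ} (hγ : γ ≤ m / B) :
    (0 < γ → msg (m + γ - 1) = E (chainSum m B D E (c w₀) msg γ)) ∧
    |(chainSum m B D E (c w₀) msg γ : ℝ) -
      exactSum m B (fun v => (collected D E (c w₀) msg v : ℝ)) γ| ≤ γ := by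
  induction γ with
  | zero => simp [chainSum, exactSum]
  | succ γ ih =>
    obtain ⟨ih1, ih2⟩ := ih (by omega)
    have hm := hmem (m + γ) (by omega)
    rw [scatterStep_chain hn hB hmQ hD hD2 hE hc hQ hmem (by omega) _ w₀ ih1 ih2] at hm
    obtain ⟨a, ha1, ha2⟩ := exists_of_mem_support_randomRound hm
    have ha : |(a : ℝ) - exactSum m B (fun v => (collected D E (c w₀) msg v : ℝ)) (γ + 1)| ≤
        (γ + 1 : ℕ) := by
      rw [exactSum_succ]
      push_cast
      rw [abs_le] at ih2 ha2 ⊢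
      constructor <;> linarith
    have hsum : chainSum m B D E (c w₀) msg (γ + 1) = a := by
      rw [chainSum, if_neg γ.succ_ne_zero, show m + (γ + 1) - 1 = m + γ by omega, ha1,
        intDecode_of_abs_sub_exactSum_le hn hB hmQ hD hD2 hE hc hQ hmem hγ ha]
    rw [hsum]
    exact ⟨fun _ => ha1, ha⟩

lemma scatter_copy (hBm : B ≤ m) (w₀ : Fin n) {s : ℕ} (hs : m + m / B ≤ s + 1)
    (hs2 : s < m + (m / B + n)) :
    msg s = E (chainSum m B D E (c w₀) msg (m / B)) := by
  have hG := Nat.div_pos hBm hB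
  obtain ⟨k, rfl⟩ := Nat.exists_eq_add_of_le (show m + m / B - 1 ≤ s by omega)
  induction k with
  | zero => exact (chainSum_spec hn hB hmQ hD hD2 hE hc hQ hmem w₀ le_rfl).1 hG
  | succ k ih =>
    have hm := hmem _ hs2
    rw [scatterStep, if_neg (by omega), if_neg (by omega), PMF.mem_support_pure_iff] at hm
    rw [hm, ← ih (by omega) (by omega)]
    congr 1

lemma abs_chainSum_sub_le (hBm : B ≤ m) (w₀ : Fin n) :
    |(chainSum m B D E (c w₀) msg (m / B) : ℝ) -
      (B : ℝ)⁻¹ * ∑ v ∈ Finset.range m, c (role hn v)| ≤ 2 * (m / B) := by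
  have hB' : (0 : ℝ) < B := by exact_mod_cast hB
  have h1 := (chainSum_spec hn hB hmQ hD hD2 hE hc hQ hmem w₀ (le_refl (m / B))).2
  have h2 : ((m / B : ℕ) : ℝ) ≤ m / B := Nat.cast_div_le
  have h3 : |exactSum m B (fun v => (collected D E (c w₀) msg v : ℝ)) (m / B) -
      (B : ℝ)⁻¹ * ∑ v ∈ Finset.range m, c (role hn v)| ≤ m / B := by
    rw [exactSum, filter_group_lt hB hBm, ← mul_sub, ← Finset.sum_sub_distrib, abs_mul,
      abs_of_pos (by positivity)]
    calc _ ≤ (B : ℝ)⁻¹ * ∑ _v ∈ Finset.range m, (1 : ℝ) := by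
          refine mul_le_mul_of_nonneg_left ((Finset.abs_sum_le_sum_abs _ _).trans
            (Finset.sum_le_sum fun v hv => ?_)) (by positivity)
          exact (collected_spec hn hD hD2 hE hc hQ hmem (Finset.mem_range.1 hv) w₀ w₀).1
      _ = m / B := by
          simp
          ring
  have h4 := abs_sub_le (chainSum m B D E (c w₀) msg (m / B) : ℝ)
    (exactSum m B (fun v => (collected D E (c w₀) msg v : ℝ)) (m / B))
    ((B : ℝ)⁻¹ * ∑ v ∈ Finset.range m, c (role hn v))
  linarith

end Coordinate

/-! ### Executions of the protocol for the `ℓ_∞` norm -/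

section Execution

variable {n d m B Q : ℕ} (hn : 0 < n) (D : ℝ) (E : ℤ → (Fin ℓ → Bool)) {y : ℝ}
  (z : Fin n → Fin d → ℝ)

/-- The step of message number `s` for coordinate `i`. -/
def scatterIdx (Q : ℕ) (i : Fin d) (s : ℕ) (hs : s < m + (m / B + n)) :
    Fin (scatterProtocol hn d m B Q D E).steps :=
  finProdFinEquiv (i, ⟨s, hs⟩)

/-- Message number `s` for coordinate `i`. -/
def scatterMsg (τ : (scatterProtocol hn d m B Q D E).Transcript) (i : Fin d) (s : ℕ) :
    Fin ℓ → Bool :=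
  if hs : s < m + (m / B + n) then τ (scatterIdx hn D E Q i s hs) else fun _ => false

variable {D E z}

lemma scatterStep_congr {s : ℕ} {x : ℝ} {prev prev' : ℕ → (Fin ℓ → Bool)}
    (h1 : m < s → prev (s - 1) = prev' (s - 1))
    (h2 : m ≤ s → ∀ v < m, group m B v = s - m → prev v = prev' v)
    (h3 : m + m / B ≤ s → prev (s - 1) = prev' (s - 1)) :
    scatterStep m B D E s x prev = scatterStep m B D E s x prev' := by
  unfold scatterStep
  split_ifs with ha hb hc
  · rfl
  · congr 3
    refine Finset.sum_congr rfl fun v hv => ?_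
    rw [Finset.mem_filter, Finset.mem_range] at hv
    rw [h2 (by omega) v hv.1 hv.2]
  · rw [h1 (by omega)]
    congr 3
    refine Finset.sum_congr rfl fun v hv => ?_
    rw [Finset.mem_filter, Finset.mem_range] at hv
    rw [h2 (by omega) v hv.1 hv.2]
  · rw [h3 (by omega)]

lemma scatterMsg_eq (τ : (scatterProtocol hn d m B Q D E).Transcript) (i : Fin d) {s : ℕ}
    (hs : s < m + (m / B + n)) : scatterMsg hn D E τ i s = τ (scatterIdx hn D E Q i s hs) :=
  dif_pos hs

lemma sender_scatterIdx (i : Fin d) {s : ℕ} (hs : s < m + (m / B + n)) :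
    (scatterProtocol hn d m B Q D E).sender (scatterIdx hn D E Q i s hs) =
      scatterSender hn m B i s := by
  change scatterSender hn m B (finProdFinEquiv.symm (finProdFinEquiv (i, ⟨s, hs⟩))).1
    (finProdFinEquiv.symm (finProdFinEquiv (i, ⟨s, hs⟩))).2 = _
  rw [Equiv.symm_apply_apply]

lemma receiver_scatterIdx (i : Fin d) {s : ℕ} (hs : s < m + (m / B + n)) :
    (scatterProtocol hn d m B Q D E).receiver (scatterIdx hn D E Q i s hs) =
      scatterReceiver hn m B i s := by
  change scatterReceiver hn m B (finProdFinEquiv.symm (finProdFinEquiv (i, ⟨s, hs⟩))).1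
    (finProdFinEquiv.symm (finProdFinEquiv (i, ⟨s, hs⟩))).2 = _
  rw [Equiv.symm_apply_apply]

lemma scatterIdx_lt (i : Fin d) {s s' : ℕ} (hs : s < m + (m / B + n)) (h : s' < s) :
    (scatterIdx hn D E Q i s' (h.trans hs) : ℕ) < scatterIdx hn D E Q i s hs := by
  rw [scatterIdx, scatterIdx, finProdFinEquiv_apply_val, finProdFinEquiv_apply_val]
  simp only
  omega

lemma send_scatterIdx (i : Fin d) {s : ℕ} (hs : s < m + (m / B + n)) (x : Fin d → ℝ)
    (v : (j : Fin (scatterProtocol hn d m B Q D E).steps) → Option (Fin ℓ → Bool)) :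
    (scatterProtocol hn d m B Q D E).send (scatterIdx hn D E Q i s hs) y x v =
      scatterStep m B D E s (x i / (y / Q)) fun s' =>
        if h : s' < m + (m / B + n) then (v (scatterIdx hn D E Q i s' h)).getD fun _ => false
        else fun _ => false := by
  change scatterStep m B D E (finProdFinEquiv.symm (finProdFinEquiv (i, ⟨s, hs⟩))).2
    (x (finProdFinEquiv.symm (finProdFinEquiv (i, ⟨s, hs⟩))).1 / (y / Q)) (fun s' =>
      if h : s' < m + (m / B + n) then
        (v (finProdFinEquiv ((finProdFinEquiv.symm (finProdFinEquiv (i, ⟨s, hs⟩))).1,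
          ⟨s', h⟩))).getD fun _ => false
      else fun _ => false) = _
  rw [Equiv.symm_apply_apply]
  rfl

lemma scatterProtocol_send (hB : 0 < B) (hBm : B ≤ m)
    (τ : (scatterProtocol hn d m B Q D E).Transcript) (i : Fin d) {s : ℕ}
    (hs : s < m + (m / B + n)) :
    (scatterProtocol hn d m B Q D E).send (scatterIdx hn D E Q i s hs) y
      (z ((scatterProtocol hn d m B Q D E).sender (scatterIdx hn D E Q i s hs)))
      ((scatterProtocol hn d m B Q D E).view
        ((scatterProtocol hn d m B Q D E).sender (scatterIdx hn D E Q i s hs))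
        (scatterIdx hn D E Q i s hs) τ) =
    scatterStep m B D E s (z (scatterSender hn m B i s) i / (y / Q)) (scatterMsg hn D E τ i) := by
  have hG := Nat.div_pos hBm hB
  rw [sender_scatterIdx]
  refine (send_scatterIdx hn i hs _ _).trans ?_
  have hprev : ∀ s' < s, scatterReceiver hn m B i s' = scatterSender hn m B i s →
      (if h : s' < m + (m / B + n) then
        ((scatterProtocol hn d m B Q D E).view (scatterSender hn m B i s)
          (scatterIdx hn D E Q i s hs) τ (scatterIdx hn D E Q i s' h)).getD fun _ => false
      else fun _ => false) = scatterMsg hn D E τ i s' := by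
    intro s' hlt hrec
    have hv := Protocol.view_eq_some (scatterProtocol hn d m B Q D E) (τ := τ)
      (scatterIdx_lt hn i hs hlt) (Or.inr ((receiver_scatterIdx hn i _).trans hrec))
    exact (dif_pos (hlt.trans hs)).trans ((congrArg (fun o : Option (Fin ℓ → Bool) =>
      o.getD fun _ => false) hv).trans (scatterMsg_eq hn τ i (hlt.trans hs)).symm)
  refine scatterStep_congr (s := s) (fun h => ?_) (fun h v hv hg => ?_) fun h => ?_
  · refine hprev _ (by omega) ?_
    unfold scatterReceiver scatterSender
    rw [Nat.sub_add_cancel (by omega), if_neg (show ¬s - 1 < m by omega),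
      if_neg (show ¬s < m by omega)]
  · refine hprev v (by omega) ?_
    unfold scatterReceiver scatterSender
    have : s - m < m / B := by
      rw [← hg, group]
      omega
    rw [if_pos hv, if_neg (by omega), if_pos (by omega), hg]
  · refine hprev _ (by omega) ?_
    unfold scatterReceiver scatterSender
    rw [Nat.sub_add_cancel (by omega), if_neg (show ¬s - 1 < m by omega),
      if_neg (show ¬s < m by omega)]

lemma scatterMsg_mem (hB : 0 < B) (hBm : B ≤ m)
    {τ : (scatterProtocol hn d m B Q D E).Transcript}
    (hτ : τ ∈ ((scatterProtocol hn d m B Q D E).transcriptLaw y z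
      (scatterProtocol hn d m B Q D E).steps).support) (i : Fin d) {s : ℕ}
    (hs : s < m + (m / B + n)) :
    scatterMsg hn D E τ i s ∈ (scatterStep m B D E s
      (z (scatterSender hn m B i s) i / (y / Q)) (scatterMsg hn D E τ i)).support := by
  rw [← scatterProtocol_send hn hB hBm τ i hs, scatterMsg_eq hn τ i hs]
  exact (scatterProtocol hn d m B Q D E).mem_support_send hτ _ (Fin.is_lt _)

lemma expect_scatterMsg (hB : 0 < B) (hBm : B ≤ m) (i : Fin d) {s : ℕ}
    (hs : s < m + (m / B + n)) (φ : (Fin ℓ → Bool) → ℝ) :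
    expect ((scatterProtocol hn d m B Q D E).transcriptLaw y z
      (scatterProtocol hn d m B Q D E).steps) (fun τ => φ (scatterMsg hn D E τ i s)) =
    expect ((scatterProtocol hn d m B Q D E).transcriptLaw y z
      (scatterProtocol hn d m B Q D E).steps) fun τ => expect (scatterStep m B D E s
        (z (scatterSender hn m B i s) i / (y / Q)) (scatterMsg hn D E τ i)) φ := by
  simp only [← scatterProtocol_send hn hB hBm _ i hs, scatterMsg_eq hn _ i hs]
  refine ((scatterProtocol hn d m B Q D E).expect_transcriptLaw_tower y z
    (scatterIdx hn D E Q i s hs) (fun τ => φ (τ (scatterIdx hn D E Q i s hs)))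
    (fun τ τ' h => by rw [h _ le_rfl])).trans ?_
  simp only [Function.update_self]
  rfl

/-- Correctness of the scatter protocol. -/
lemma scatterProtocol_correct (hB : 0 < B) (hBm : B ≤ m) (hmn : m ≤ n)
    (hmQ : m ≤ B * Q) (hQ : 0 < Q) (hD : D = Q * (Q + 2)) (hD2 : 2 * D < 2 ^ ℓ)
    (hE : ∀ a b, E a = E b → |a - b| < 2 ^ ℓ → a = b) (hy : 0 < y)
    (hz : ∀ u v i, |z u i - z v i| ≤ y) :
    ∃ est : (scatterProtocol hn d m B Q D E).Transcript → Fin d → ℝ,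
      (∀ τ ∈ ((scatterProtocol hn d m B Q D E).transcriptLaw y z
          (scatterProtocol hn d m B Q D E).steps).support, ∀ v,
        (scatterProtocol hn d m B Q D E).output v y (z v)
          ((scatterProtocol hn d m B Q D E).view v (scatterProtocol hn d m B Q D E).steps τ) =
            est τ) ∧
      (∀ i, expect ((scatterProtocol hn d m B Q D E).transcriptLaw y z
          (scatterProtocol hn d m B Q D E).steps) (fun τ => est τ i) = sampleMean m z i) ∧
      ∀ τ ∈ ((scatterProtocol hn d m B Q D E).transcriptLaw y z
          (scatterProtocol hn d m B Q D E).steps).support, ∀ i,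
        |est τ i - sampleMean m z i| ≤ 2 * (y / Q) := by
  have hm : 0 < m := hB.trans_le hBm
  have hm' : (0 : ℝ) < m := by exact_mod_cast hm
  have hB' : (0 : ℝ) < B := by exact_mod_cast hB
  have hQ' : (0 : ℝ) < Q := by exact_mod_cast hQ
  have hG := Nat.div_pos hBm hB
  set P := scatterProtocol hn d m B Q D E with hP
  set g := y / Q with hg
  have hg0 : 0 < g := by positivity
  set c : Fin d → Fin n → ℝ := fun i v => z v i / g with hcdef
  have hc : ∀ i u v, |c i u - c i v| ≤ Q := by
    intro i u v
    rw [hcdef]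
    simp only
    rw [← sub_div, abs_div, abs_of_pos hg0, div_le_iff₀ hg0]
    refine (hz u v i).trans (le_of_eq ?_)
    rw [hg]
    field_simp
  have hmem : ∀ τ ∈ (P.transcriptLaw y z P.steps).support, ∀ i : Fin d, ∀ s < m + (m / B + n),
      scatterMsg hn D E τ i s ∈ (scatterStep m B D E s (c i (scatterSender hn m B i s))
        (scatterMsg hn D E τ i)).support := fun τ hτ i s hs => scatterMsg_mem hn hB hBm hτ i hs
  have hmean : ∀ i, sampleMean m z i =
      g * (B / m) * ((B : ℝ)⁻¹ * ∑ v ∈ Finset.range m, c i (role hn v)) := by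
    intro i
    rw [sampleMean, sum_filter_val_lt hn hmn fun v => z v i, hcdef]
    simp only
    rw [← Finset.sum_div]
    field_simp
  have hcoll : ∀ i, ∀ v < m, expect (P.transcriptLaw y z P.steps) (fun τ =>
      (collected D E (c i (role hn 0)) (scatterMsg hn D E τ i) v : ℝ)) = c i (role hn v) := by
    intro i v hv
    refine (expect_scatterMsg hn hB hBm i (by omega) fun b =>
      (intDecode E D (c i (role hn 0)) b : ℝ)).trans ?_
    rw [← expect_const (P.transcriptLaw y z P.steps) (c i (role hn v))]
    congr 1
    funext τ
    rw [scatterStep, if_pos hv, scatterSender, if_pos hv, expect_randomRound (c := 0), add_zero]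
    intro a ha
    rw [intDecode_of_abs_sub_le_one (c := c i) hD hD2 hE (hc i) hQ ha, add_zero]
  have hchain : ∀ i, ∀ γ ≤ m / B, expect (P.transcriptLaw y z P.steps) (fun τ =>
      (chainSum m B D E (c i (role hn 0)) (scatterMsg hn D E τ i) γ : ℝ)) =
        exactSum m B (fun v => c i (role hn v)) γ := by
    intro i γ hγ
    induction γ with
    | zero => simp [chainSum, exactSum, expect_const]
    | succ γ ih =>
      have h1 : expect (P.transcriptLaw y z P.steps) (fun τ =>
          (chainSum m B D E (c i (role hn 0)) (scatterMsg hn D E τ i) (γ + 1) : ℝ)) =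
        expect (P.transcriptLaw y z P.steps) fun τ =>
          (chainSum m B D E (c i (role hn 0)) (scatterMsg hn D E τ i) γ : ℝ) +
          (B : ℝ)⁻¹ * ∑ v ∈ (Finset.range m).filter (fun v => group m B v = γ),
            (collected D E (c i (role hn 0)) (scatterMsg hn D E τ i) v : ℝ) := by
        have h2 := expect_scatterMsg (z := z) (y := y) (Q := Q) (D := D) (E := E) hn hB hBm i
          (s := m + γ) (by omega) fun b =>
            (intDecode E D (groupWeight m B (γ + 1) * c i (role hn 0)) b : ℝ)
        refine Eq.trans ?_ (h2.trans (expect_congr fun τ hτ => ?_))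
        · simp only [chainSum, if_neg γ.succ_ne_zero]
          rfl
        · obtain ⟨h3, h4⟩ := chainSum_spec hn hB hmQ hD hD2 hE (hc i) hQ (hmem τ hτ i)
            (role hn 0) (γ := γ) (by omega)
          have h5 := scatterStep_chain hn hB hmQ hD hD2 hE (hc i) hQ (hmem τ hτ i)
            (γ := γ) (by omega) (scatterSender hn m B i (m + γ)) (role hn 0) h3 h4
          simp only [hcdef] at h5
          rw [h5, expect_randomRound (c := 0), add_zero]
          intro a ha
          rw [add_zero, intDecode_of_abs_sub_exactSum_le hn hB hmQ hD hD2 hE (hc i) hQ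
            (hmem τ hτ i) hγ (w₀ := role hn 0)]
          rw [exactSum_succ]
          push_cast
          rw [abs_le] at h4 ha ⊢
          constructor <;> linarith
      rw [h1, expect_add, ih (by omega), expect_const_mul, expect_sum, exactSum_succ]
      congr 2
      refine Finset.sum_congr rfl fun v hv => hcoll i v ?_
      exact Finset.mem_range.1 (Finset.mem_filter.1 hv).1
  refine ⟨fun τ i => g * (B / m) * chainSum m B D E (c i (role hn 0)) (scatterMsg hn D E τ i)
    (m / B), fun τ hτ v => ?_, fun i => ?_, fun τ hτ i => ?_⟩
  · funext i
    have hlt : m + (m / B + (v : ℕ)) < m + (m / B + n) := by omega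
    have hview : P.view v P.steps τ (scatterIdx hn D E Q i _ hlt) =
        some (τ (scatterIdx hn D E Q i _ hlt)) := by
      refine Protocol.view_eq_some _ (Fin.is_lt _) (Or.inl ((sender_scatterIdx hn i hlt).trans ?_))
      rw [scatterSender, if_neg (by omega), if_neg (by omega), ← add_assoc,
        Nat.add_sub_cancel_left, role_val]
    have hcopy := scatter_copy hn hB hmQ hD hD2 hE (hc i) hQ (hmem τ hτ i) hBm (role hn 0)
      (s := m + (m / B + v)) (by omega) hlt
    rw [← scatterMsg_eq hn τ i hlt, hcopy] at hview
    have h6 := (chainSum_spec hn hB hmQ hD hD2 hE (hc i) hQ (hmem τ hτ i) (role hn 0)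
      (le_refl (m / B))).2
    have h7 := intDecode_of_abs_sub_exactSum_le hn hB hmQ hD hD2 hE (hc i) hQ (hmem τ hτ i)
      le_rfl h6 v
    change (if y ≤ 0 then z v i else y / Q * (B / m) *
      intDecode E D (groupWeight m B (m / B) * (z v i / (y / Q)))
        ((P.view v P.steps τ (scatterIdx hn D E Q i _ hlt)).getD fun _ => false)) = _
    rw [if_neg (not_le.2 hy), hview]
    exact congrArg (fun a : ℤ => g * (B / m) * (a : ℝ)) h7
  · rw [expect_const_mul, hchain i _ le_rfl, exactSum, filter_group_lt hB hBm, hmean]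
  · have h8 := abs_chainSum_sub_le hn hB hmQ hD hD2 hE (hc i) hQ (hmem τ hτ i) hBm (role hn 0)
    rw [hmean, ← mul_sub, abs_mul, abs_of_pos (by positivity)]
    calc _ ≤ g * (B / m) * (2 * (m / B)) := mul_le_mul_of_nonneg_left h8 (by positivity)
      _ = 2 * g := by field_simp

end Execution

end ScatterAnalysis

/-! ### Conclusion -/

lemma eq_of_vecNorm_sub_le_zero {p : ℝ≥0∞} (hp : p = 1 ∨ p = 2 ∨ p = ∞) {d : ℕ} {x y : Fin d → ℝ}
    (h : vecNorm p (x - y) ≤ 0) : x = y := by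
  have h0 := le_antisymm h (vecNorm_nonneg hp _)
  have h1 : WithLp.toLp p (x - y) = 0 := by
    rcases hp with rfl | rfl | rfl <;> exact norm_eq_zero.1 h0
  exact sub_eq_zero.1 (congrArg WithLp.ofLp h1)

namespace Protocol

variable {n d : ℕ} {P : Protocol n d} {p : ℝ≥0∞}

lemma EstimatesMean.mono {y : ℝ} {x : Fin n → Fin d → ℝ} {s s' : ℝ}
    (h : P.EstimatesMean p y x s) (hs : s ≤ s') : P.EstimatesMean p y x s' := by
  obtain ⟨est, h1, h2, h3⟩ := h
  exact ⟨est, h1, h2, h3.trans hs⟩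

/-- If all inputs are equal, then it suffices that each machine outputs its own vector. -/
lemma estimatesMean_of_forall_eq (hp : p = 1 ∨ p = 2 ∨ p = ∞) (hn : 0 < n) {y : ℝ}
    {x : Fin n → Fin d → ℝ} (hx : ∀ u v, x u = x v)
    (hout : ∀ r x v, P.output r y x v = x) {s : ℝ} (hs : 0 ≤ s) : P.EstimatesMean p y x s := by
  have hn' : (n : ℝ) ≠ 0 := by exact_mod_cast hn.ne'
  have hmean : mean x = x ⟨0, hn⟩ := by
    rw [mean, Finset.sum_congr rfl fun v _ => hx v ⟨0, hn⟩, Finset.sum_const, Finset.card_univ,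
      Fintype.card_fin, ← Nat.cast_smul_eq_nsmul ℝ, smul_smul, inv_mul_cancel₀ hn', one_smul]
  have hexp : P.expVec y x (fun _ => x ⟨0, hn⟩) = x ⟨0, hn⟩ := by
    rw [expVec, ← Finset.sum_smul, sum_toReal_eq_one, one_smul]
  refine ⟨fun _ => x ⟨0, hn⟩, fun ω _ v => ?_, hexp.trans hmean.symm, ?_⟩
  · rw [machineOutput, hout]
    exact hx _ _
  · rw [variance, hexp]
    simpa [vecNorm_zero hp] using hs

end Protocol

/-- The case of a norm that can be compared with the `ℓ_1` norm and the sum of squares. -/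
lemma exists_ring_protocol {p : ℝ≥0∞} (hp : p = 1 ∨ p = 2 ∨ p = ∞) {n d Q : ℕ} (hn : 0 < n)
    (hd : 0 < d) (hQ : 0 < Q) {κ c : ℝ} (hκ : 0 ≤ κ) (hc : 0 < c) (hκc : κ * c ^ 2 = d)
    (h1 : ∀ x : Fin d → ℝ, vecNorm p x ^ 2 ≤ κ * ∑ i, x i ^ 2)
    (h2 : ∀ x : Fin d → ℝ, ∑ i, |x i| ≤ c * vecNorm p x) :
    ∃ P : Protocol n d, (∀ r, P.bits r ≤ (22 * Nat.clog 2 Q + 63) * d) ∧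
      ∀ (y : ℝ) (x : Fin n → Fin d → ℝ), (∀ u v, vecNorm p (x u - x v) ≤ y) →
        P.EstimatesMean p y x (10 * (y ^ 2 / Q)) := by
  set t := Nat.clog 2 Q with ht
  have hQt : Q ≤ 2 ^ t := Nat.le_pow_clog (by norm_num) Q
  set N := d * Q with hN
  have hN0 : 0 < N := Nat.mul_pos hd hQ
  set m := min n N with hm
  have hm0 : 0 < m := lt_min hn hN0
  -- the number of samples per machine, chosen such that `N ≤ m * r ≤ 2 * N`
  set r := N / m + 1 with hr
  have hmr : N ≤ m * r := (Nat.lt_mul_div_succ N hm0).le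
  have hR : m * r ≤ 2 * Q * d := by
    have h3 : m * (N / m) ≤ N := Nat.mul_div_le N m
    have h4 : m ≤ N := min_le_right _ _
    rw [hr, Nat.mul_add, mul_one, show 2 * Q * d = N + N by rw [hN]; ring]
    omega
  have hL : (27 * (3 * (2 * (2 * Q) + 1))) ^ d ≤ 2 ^ ((t + 9) * d) := by
    rw [pow_mul]
    refine Nat.pow_le_pow_left ?_ d
    rw [pow_add]
    omega
  obtain ⟨E, hE⟩ := exists_pair_code (d := d) (M := 2 * Q) (by omega) hL
  have hE' : ∀ s s', E s = E s' → ∑ i, |s.1 i - s'.1 i| ≤ 4 * (d : ℤ) →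
      ∑ i, |s.2 i| ≤ ((2 * Q * d : ℕ) : ℤ) → ∑ i, |s'.2 i| ≤ ((2 * Q * d : ℕ) : ℤ) → s = s' := by
    intro s s' h3 h4 h5 h6
    refine hE s s' h3 h4 ?_ ?_
    · exact_mod_cast h5
    · exact_mod_cast h6
  refine ⟨ringProtocol hn m r (2 * Q * d) c E, fun v => ?_, fun y x hx => ?_⟩
  · refine (ringProtocol_bits_le hn m r _ c E v).trans ?_
    rw [← mul_assoc]
    exact Nat.mul_le_mul_right _ (by omega)
  · have hy0 : 0 ≤ y := (vecNorm_nonneg hp _).trans (hx ⟨0, hn⟩ ⟨0, hn⟩)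
    rcases hy0.eq_or_lt with rfl | hy
    · refine Protocol.estimatesMean_of_forall_eq hp hn
        (fun u v => eq_of_vecNorm_sub_le_zero hp (hx u v)) (fun r x v => ?_) (by positivity)
      funext i
      exact if_pos le_rfl
    · refine (Protocol.estimatesMean_of_sampleMean _ hp hm0 (min_le_left n N)
        (expect_sampling_error_le hp hn hd hQ hx) (A := 4 * (y ^ 2 / Q)) fun σ => ?_).mono
          (le_of_eq (by ring))
      obtain ⟨est, h3, h4, h5⟩ := ringProtocol_correct (z := fun r => x (σ.symm r)) hn hd
        (mul_pos hc hy) (fun u v => (h2 (x (σ.symm u) - x (σ.symm v))).trans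
          (mul_le_mul_of_nonneg_left (hx _ _) hc.le)) hm0 (min_le_left n N) hR hE' hy
        (Nat.succ_pos _)
      refine ⟨est, h3, h4, ?_⟩
      refine (expect_mono fun τ _ => h1 (est τ - sampleMean m fun r => x (σ.symm r))).trans ?_
      rw [expect_const_mul]
      refine (mul_le_mul_of_nonneg_left h5 hκ).trans ?_
      have hmr' : (d * Q : ℝ) ≤ m * r := by exact_mod_cast hmr
      have hd' : (0 : ℝ) < d := by exact_mod_cast hd
      have hQ' : (0 : ℝ) < Q := by exact_mod_cast hQ
      calc κ * ((2 * (c * y)) ^ 2 / (m * r)) = 4 * (κ * c ^ 2) * y ^ 2 / (m * r) := by ring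
        _ = 4 * d * y ^ 2 / (m * r) := by rw [hκc]
        _ ≤ 4 * d * y ^ 2 / (d * Q) := by gcongr
        _ = 4 * (y ^ 2 / Q) := by field_simp

lemma exists_scatter_protocol {n d Q : ℕ} (hn : 0 < n) (hd : 0 < d) (hQ : 0 < Q) :
    ∃ P : Protocol n d, (∀ r, P.bits r ≤ (22 * Nat.clog 2 Q + 63) * d) ∧
      ∀ (y : ℝ) (x : Fin n → Fin d → ℝ), (∀ u v, vecNorm ∞ (x u - x v) ≤ y) →
        P.EstimatesMean ∞ y x (10 * (y ^ 2 / Q)) := by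
  have hp : (∞ : ℝ≥0∞) = 1 ∨ (∞ : ℝ≥0∞) = 2 ∨ (∞ : ℝ≥0∞) = ∞ := Or.inr (Or.inr rfl)
  have hQ' : (1 : ℝ) ≤ Q := by exact_mod_cast hQ
  set t := Nat.clog 2 Q with ht
  have hQt : (Q : ℝ) ≤ 2 ^ t := by exact_mod_cast Nat.le_pow_clog (by norm_num) Q
  set m := min n (d * Q) with hm
  set B := min n d with hB
  have hm0 : 0 < m := lt_min hn (Nat.mul_pos hd hQ)
  have hB0 : 0 < B := lt_min hn hd
  have hBm : B ≤ m := min_le_min_left n (Nat.le_mul_of_pos_right d hQ)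
  have hmQ : m ≤ B * Q := by
    rcases le_total n d with h | h
    · rw [hB, min_eq_left h]
      exact (min_le_left _ _).trans (Nat.le_mul_of_pos_right n hQ)
    · rw [hB, min_eq_right h]
      exact min_le_right _ _
  -- The sums over the groups are bounded by `Q` times the `Q + 1` for one value (the distance of
  -- the inputs and one rounding), plus `Q` for the roundings in the chain.
  have hD : 2 * ((Q : ℝ) * (Q + 2)) < 2 ^ (2 * t + 3) := by
    rw [pow_add, mul_comm 2 t, pow_mul]
    nlinarith [pow_le_pow_left₀ (by positivity : (0 : ℝ) ≤ Q) hQt 2]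
  obtain ⟨E, hE⟩ := exists_int_code (2 * t + 3)
  refine ⟨scatterProtocol hn d m B Q (Q * (Q + 2)) E, fun v => ?_, fun y x hx => ?_⟩
  · refine (scatterProtocol_bits_le hn hB0 (min_le_left _ _) hBm (min_le_right _ _) v).trans ?_
    rw [mul_right_comm]
    exact Nat.mul_le_mul_right _ (by omega)
  · have hy0 : 0 ≤ y := (vecNorm_nonneg hp _).trans (hx ⟨0, hn⟩ ⟨0, hn⟩)
    rcases hy0.eq_or_lt with rfl | hy
    · refine Protocol.estimatesMean_of_forall_eq hp hn
        (fun u v => eq_of_vecNorm_sub_le_zero hp (hx u v)) (fun r x v => ?_) (by positivity)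
      funext i
      exact if_pos le_rfl
    · refine (Protocol.estimatesMean_of_sampleMean _ hp hm0 (min_le_left n (d * Q))
        (expect_sampling_error_le hp hn hd hQ hx) (A := 4 * (y ^ 2 / Q)) fun σ => ?_).mono
          (le_of_eq (by ring))
      obtain ⟨est, h3, h4, h5⟩ := scatterProtocol_correct (z := fun r => x (σ.symm r)) hn hB0 hBm
        (min_le_left _ _) hmQ hQ rfl hD hE hy
        (fun u v i => (abs_le_vecNorm_top (x (σ.symm u) - x (σ.symm v)) i).trans (hx _ _))
      refine ⟨est, h3, h4, ?_⟩
      rw [← expect_const ((scatterProtocol hn d m B Q (Q * (Q + 2)) E).transcriptLaw y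
        (fun r => x (σ.symm r)) (scatterProtocol hn d m B Q (Q * (Q + 2)) E).steps)
        (4 * (y ^ 2 / Q))]
      refine expect_mono fun τ hτ => ?_
      have h6 : vecNorm ∞ (est τ - sampleMean m fun r => x (σ.symm r)) ≤ 2 * (y / Q) :=
        vecNorm_top_le (by positivity) fun i => h5 τ hτ i
      refine (pow_le_pow_left₀ (vecNorm_nonneg hp _) h6 2).trans ?_
      rw [mul_pow, div_pow]
      have h7 : y ^ 2 / (Q : ℝ) ^ 2 ≤ y ^ 2 / Q := by
        gcongr
        nlinarith
      linarith

lemma exists_protocol {p : ℝ≥0∞} (hp : p = 1 ∨ p = 2 ∨ p = ∞) {n d Q : ℕ} (hn : 0 < n)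
    (hd : 0 < d) (hQ : 0 < Q) :
    ∃ P : Protocol n d, (∀ r, P.bits r ≤ (22 * Nat.clog 2 Q + 63) * d) ∧
      ∀ (y : ℝ) (x : Fin n → Fin d → ℝ), (∀ u v, vecNorm p (x u - x v) ≤ y) →
        P.EstimatesMean p y x (10 * (y ^ 2 / Q)) := by
  have hd' : (0 : ℝ) < d := by exact_mod_cast hd
  rcases hp with rfl | rfl | rfl
  · refine exists_ring_protocol (Or.inl rfl) hn hd hQ hd'.le one_pos (by ring) (fun x => ?_)
      fun x => ?_
    · rw [vecNorm_one]
      simpa using sq_sum_le_card_mul_sum_sq (s := Finset.univ) (f := fun i => |x i|)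
    · rw [vecNorm_one, one_mul]
  · refine exists_ring_protocol (Or.inr (Or.inl rfl)) hn hd hQ zero_le_one
      (Real.sqrt_pos.2 hd') (by rw [one_mul, Real.sq_sqrt hd'.le]) (fun x => ?_) fun x => ?_
    · rw [vecNorm_two_sq, one_mul]
    · refine abs_le_of_sq_le_sq' ?_ (mul_nonneg (Real.sqrt_nonneg _)
        (vecNorm_nonneg (Or.inr (Or.inl rfl)) x)) |>.2
      rw [mul_pow, Real.sq_sqrt hd'.le, vecNorm_two_sq]
      simpa using sq_sum_le_card_mul_sum_sq (s := Finset.univ) (f := fun i => |x i|)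
  · exact exists_scatter_protocol hn hd hQ

/-- The silent protocol of the zero-dimensional case. -/
lemma exists_protocol_zero {p : ℝ≥0∞} (hp : p = 1 ∨ p = 2 ∨ p = ∞) {n : ℕ} (hn : 0 < n) :
    ∃ P : Protocol n 0, (∀ r, P.bits r = 0) ∧
      ∀ (y : ℝ) (x : Fin n → Fin 0 → ℝ) (s : ℝ), 0 ≤ s → P.EstimatesMean p y x s := by
  refine ⟨{ steps := 0, sender := Fin.elim0, receiver := Fin.elim0, len := Fin.elim0,
            send := fun i => i.elim0, output := fun _ _ x _ => x }, fun r => ?_,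
    fun y x s hs => Protocol.estimatesMean_of_forall_eq hp hn (fun u v => Subsingleton.elim _ _)
      (fun _ _ _ => rfl) hs⟩
  simp [Protocol.bits]

lemma clog_ceil_le {q : ℝ} (hq : 1 < q) :
    (Nat.clog 2 ⌈q⌉₊ : ℝ) ≤ 2 + Real.logb 2 q := by
  have hQ : 1 < ⌈q⌉₊ := Nat.lt_ceil.2 (by exact_mod_cast hq)
  have h1 := Nat.pow_pred_clog_lt_self (b := 2) (by norm_num) hQ
  have h2 : (2 : ℝ) ^ (Nat.clog 2 ⌈q⌉₊ - 1) < 2 * q := by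
    have h3 : ((2 : ℝ) ^ (Nat.clog 2 ⌈q⌉₊ - 1)) < ⌈q⌉₊ := by exact_mod_cast h1
    have h4 := Nat.ceil_lt_add_one (show 0 ≤ q by linarith)
    linarith
  have h5 : ((Nat.clog 2 ⌈q⌉₊ - 1 : ℕ) : ℝ) ≤ 1 + Real.logb 2 q := by
    have h6 := Real.logb_le_logb_of_le (b := 2) (by norm_num) (by positivity) h2.le
    rw [Real.logb_pow, Real.logb_self_eq_one (by norm_num), mul_one,
      Real.logb_mul (by norm_num) (by linarith), Real.logb_self_eq_one (by norm_num)] at h6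
    exact h6
  have h7 : (Nat.clog 2 ⌈q⌉₊ : ℝ) ≤ ((Nat.clog 2 ⌈q⌉₊ - 1 : ℕ) : ℝ) + 1 := by
    exact_mod_cast Nat.le_succ_of_pred_le le_rfl
  linarith

end MeanEst

end

theorem theorem2 (q₀ : ℝ) (hq₀ : 1 < q₀) :
    ∃ C : ℝ, 0 < C ∧
      ∀ p : ℝ≥0∞, (p = 1 ∨ p = 2 ∨ p = ∞) →
      ∀ n d : ℕ, 0 < n →
      ∀ q : ℝ, q₀ ≤ q →
      ∃ P : MeanEst.Protocol n d,
        (∀ (v : Fin n) (ω : P.Outcome), (P.machineBits v ω : ℝ) ≤ C * (d * Real.logb 2 q)) ∧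
        ∀ (y : ℝ) (x : Fin n → Fin d → ℝ),
          (∀ u v, MeanEst.vecNorm p (x u - x v) ≤ y) →
          P.EstimatesMean p y x (C * (y ^ 2 / q)) := by
  have hlog₀ : 0 < Real.logb 2 q₀ := Real.logb_pos (by norm_num) hq₀
  refine ⟨107 * (1 / Real.logb 2 q₀ + 1), by positivity, fun p hp n d hn q hq => ?_⟩
  have hq1 : 1 < q := hq₀.trans_le hq
  have hlog : Real.logb 2 q₀ ≤ Real.logb 2 q :=
    Real.logb_le_logb_of_le (by norm_num) (by linarith) hq
  have hC : 10 ≤ 107 * (1 / Real.logb 2 q₀ + 1) := by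
    have : 0 < 1 / Real.logb 2 q₀ := by positivity
    linarith
  rcases Nat.eq_zero_or_pos d with rfl | hd
  · obtain ⟨P, h1, h2⟩ := MeanEst.exists_protocol_zero hp hn
    refine ⟨P, fun v ω => ?_, fun y x _ => h2 y x _ (by positivity)⟩
    rw [MeanEst.Protocol.machineBits, h1]
    simp
  · have hQ : 0 < ⌈q⌉₊ := Nat.ceil_pos.2 (by linarith)
    obtain ⟨P, h1, h2⟩ := MeanEst.exists_protocol hp hn hd hQ
    refine ⟨P, fun v ω => ?_, fun y x hx => (h2 y x hx).mono ?_⟩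
    · have h3 : (P.machineBits v ω : ℝ) ≤ (22 * Nat.clog 2 ⌈q⌉₊ + 63) * d := by
        exact_mod_cast h1 (ω.1 v)
      have h4 := MeanEst.clog_ceil_le hq1
      -- the additive constant is absorbed by `log q`, as `log q ≥ log q₀ > 0`
      have h5 : 1 ≤ 1 / Real.logb 2 q₀ * Real.logb 2 q := by
        rw [one_div, inv_mul_eq_div, le_div_iff₀ hlog₀, one_mul]
        exact hlog
      have hd' : (0 : ℝ) ≤ d := Nat.cast_nonneg d
      refine h3.trans ?_
      calc (22 * (Nat.clog 2 ⌈q⌉₊ : ℝ) + 63) * d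
          ≤ (107 * (1 / Real.logb 2 q₀ * Real.logb 2 q + Real.logb 2 q)) * d := by
            refine mul_le_mul_of_nonneg_right ?_ hd'
            linarith
        _ = _ := by ring
    · have hq0 : 0 < q := by linarith
      calc 10 * (y ^ 2 / (⌈q⌉₊ : ℝ)) ≤ 10 * (y ^ 2 / q) := by
            gcongr
            exact Nat.le_ceil q
        _ ≤ _ := mul_le_mul_of_nonneg_right hC (by positivity)
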